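/- Work in the unit-cost model: following a pointer, comparing two keys, one (real) arithmetic operation ($\exp$, $\log$ and rounding included) and drawing one uniform random integer from $\{1,\dots,c\}$ each take $O(1)$ steps. Fix an integer $t\ge 2$. An (augmented) B-tree of minimum degree $t$ stores a finite set $S$ of elements of a linear order: all elements are in the leaves, in increasing order and one leaf for each element; all leaves have the same depth; each internal node other than the root has between $t$ and $2t$ children, and an internal root has between $2$ and $2t$; each internal node stores the number of leaves below it and, for each of its children, the largest element below that child. (The empty tree stores $\emptyset$.) A random element is drawn by descending from the root, choosing each child with probability proportional to its number of leaves. There is a constant $C>0$, depending only on $t$, such that the following holds. 1. For a B-tree that stores a set $S$ with $m$ elements, insertion of $x$ yields a B-tree that stores $S\cup\{x\}$, deletion of $x$ yields a B-tree that stores $S\setminus\{x\}$, and a membership query decides whether $x\in S$; the random descent returns each $x\in S$ with probability $1/m$. Each of these operations takes at most $C\log(m+2)$ steps (that is, $O(\log m)$), the random descent for every outcome of the random choices. 2. Let $1\le k\le n$, let $\epsilon,\gamma\in(0,1)$, let $A_1,\dots,A_n$ be finite sets stored in B-trees, and let $m=\max_i|A_i|$. Let $C^*$ be the maximum of $|\bigcup_{j\in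 K}A_j|$ over all $K\subseteq\{1,\dots,n\}$ with $|K|=k$. Consider the following algorithm ApproximateMaximumCover. Put $\xi=\min\left(\frac{\epsilon e^{-1/4}}{4ek},\epsilon\right)$, $\epsilon'=\frac{\xi}{4k}$, $\gamma'=\gamma\big/\left(n\sum_{i=0}^{k}\binom{n}{i}\right)$, and let $w$ be the least integer with $e^{-w(\epsilon'/3)^2/2}\le\gamma'/4$. Draw a list $R_i$ of $w$ independent random elements of each nonempty $A_i$ (no elements if $A_i=\emptyset$). In each of $k$ rounds remove from each list $R_i$, by membership queries, the samples that lie in the set picked last, estimate the number of uncovered elements of each remaining $A_i$ by $\frac{r_i}{w}|A_i|$, where $r_i$ is the number of samples left in $R_i$, and pick a set with the largest estimate. Return the set $H$ of picked indices and the sum $z$ of the estimates of the picked sets at the time they were picked. With probability at least $1-\gamma$ the algorithm returns a $(1-\frac1e)$-approximation: $$|H|=k,\qquad \Big|\bigcup_{j\in H}A_j\Big|\ge\Big(1-\frac1e\Big)C^*,\qquad (1-\epsilon)\Big|\bigcup_{j\in H}A_j\Big|\le z\le(1+\epsilon)\Big|\bigcup_{j\in H}A_j\Big| .$$ For every outcome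 of the random choices, its total number of steps, those of the B-tree operations included, is at most $C\,(T+R\log m+Q\log m)$ (with $\log 0:=0$), where $$T=Q=\frac{k^5}{\epsilon^2}\Big(k\log\frac{3n}{k}+\log\frac1\gamma\Big)n,\qquad R=\frac{k^4}{\epsilon^2}\Big(k\log\frac{3n}{k}+\log\frac1\gamma\Big)n .$$ -/

import Mathlib

/-! ## Cost model

Programs are written in a monad that carries a step counter.  Every pointer access, key comparison,
arithmetic operation and random draw costs a constant number of steps; a pass over a list costs at
least one step per cell.  The only steps that are counted are those charged by `ticks` / `tick`. -/

/-- A value together with the number of steps that were used to compute it. -/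
structure Timed (β : Type) where
  val : β
  time : ℕ

namespace Timed

instance : Monad Timed where
  pure b := ⟨b, 0⟩
  bind x f := ⟨(f x.val).val, x.time + (f x.val).time⟩

/-- Spend `c` steps. -/
def ticks (c : ℕ) : Timed Unit := ⟨(), c⟩

/-- Spend one step. -/
def tick : Timed Unit := ticks 1

end Timed

/-- A randomized program: the joint law of its result and its number of steps. -/
def RTimed (β : Type) : Type := PMF (Timed β)

namespace RTimed

noncomputable instance : Monad RTimed where
  pure b := PMF.pure ⟨b, 0⟩
  bind p f := PMF.bind p fun a =>
    PMF.map (fun b => (⟨b.val, a.time + b.time⟩ : Timed _)) (f a.val)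

/-- A deterministic program, seen as a randomized one. -/
noncomputable def lift {β : Type} (x : Timed β) : RTimed β := PMF.pure x

/-- Draw a uniform integer from `{1, …, c}` in one step (for `c = 0` the result is `0`). -/
noncomputable def uniformIcc (c : ℕ) : RTimed ℕ :=
  if h : (Finset.Icc 1 c).Nonempty then
    PMF.map (fun i => (⟨i, 1⟩ : Timed ℕ)) (PMF.uniformOfFinset (Finset.Icc 1 c) h)
  else PMF.pure ⟨0, 1⟩

/-- The law of the result, without the step counter. -/
noncomputable def law {β : Type} (p : RTimed β) : PMF β := PMF.map Timed.val p

/-- The set of all results with step counts that occur with positive probability. -/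
def outcomes {β : Type} (p : RTimed β) : Set (Timed β) := PMF.support p

/-- The probability that the result satisfies `P`. -/
noncomputable def prob {β : Type} (p : RTimed β) (P : β → Prop) : ENNReal :=
  (law p).toOuterMeasure {b | P b}

end RTimed

/-! ## Augmented B-trees

All data are in the leaves and all leaves have the same depth.  An internal node stores the number
of leaves below it and, for each child, the largest element in the subtree of that child. -/

/-- An internal node: the stored leaf count and the children, each with the stored largest element
of its subtree. -/
structure BNode (α β : Type) where
  count : ℕ
  children : List (α × β)

/-- Subtrees of height `h`; a subtree of height `0` is a leaf and holds one element. -/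
def BSub (α : Type) : ℕ → Type
  | 0 => α
  | h + 1 => BNode α (BSub α h)

namespace BSub

/-- The stored number of leaves (`1` for a leaf). -/
def count {α : Type} : (h : ℕ) → BSub α h → ℕ
  | 0, _ => 1
  | _ + 1, (v : BNode α _) => v.count

/-- The elements in the leaves, from left to right. -/
def leaves {α : Type} : (h : ℕ) → BSub α h → List α
  | 0, x => [x]
  | h + 1, (v : BNode α (BSub α h)) => v.children.flatMap fun e => leaves h e.2

/-- Structural invariants of a subtree in a B-tree of minimum degree `t`: the top node, if it is
internal, has between `lo` and `2 * t` children, all internal nodes below it have between `t` and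
`2 * t` children, and the stored counts and largest elements are correct. -/
def WF {α : Type} [LinearOrder α] (t : ℕ) : (lo h : ℕ) → BSub α h → Prop
  | _, 0, _ => True
  | lo, h + 1, (v : BNode α (BSub α h)) =>
      lo ≤ v.children.length ∧ v.children.length ≤ 2 * t ∧
      v.count = (v.children.flatMap fun e => leaves h e.2).length ∧
      ∀ e ∈ v.children, IsGreatest {y | y ∈ leaves h e.2} e.1 ∧ WF t t h e.2

/-- The first child whose largest element is at least `x`. -/
def findChild {α β : Type} [LinearOrder α] (x : α) : List (α × β) → Timed (Option β)
  | [] => do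
      Timed.tick
      pure none
  | e :: l => do
      Timed.tick
      if x ≤ e.1 then pure (some e.2) else findChild x l

/-- Membership query. -/
def query {α : Type} [LinearOrder α] (x : α) : (h : ℕ) → BSub α h → Timed Bool
  | 0, (y : α) => do
      Timed.tick
      pure (decide (x = y))
  | h + 1, (v : BNode α (BSub α h)) => do
      let c ← findChild x v.children
      match c with
      | none => pure false
      | some s => query x h s

/-- Make an internal node from a list of children (no node from no children), and return it with
its largest element.  The count and the largest element are obtained in one pass. -/
def pack {α : Type} {h : ℕ} (l : List (α × BSub α h)) : Timed (List (α × BSub α (h + 1))) := do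
  Timed.ticks (1 + l.length)
  match l.getLast? with
  | none => pure []
  | some e => pure [(e.1, (⟨(l.map fun e => count h e.2).sum, l⟩ : BNode α (BSub α h)))]

/-- Make one node from a list of children or, if there are more than `2 * t` of them, two nodes of
about equal size. -/
def regroup {α : Type} (t : ℕ) {h : ℕ} (l : List (α × BSub α h)) :
    Timed (List (α × BSub α (h + 1))) := do
  Timed.ticks (1 + l.length)
  if l.length ≤ 2 * t then pack l
  else do
    Timed.ticks (1 + l.length)
    let a ← pack (l.take (l.length / 2))
    let b ← pack (l.drop (l.length / 2))
    pure (a ++ b)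

/-- Apply `f` to the child into which `x` has to be inserted: the first one whose largest element
is at least `x`, and the last one if there is none; the result replaces the child. -/
def insertChildren {α β : Type} [LinearOrder α] (x : α) (f : β → Timed (List (α × β))) :
    List (α × β) → Timed (List (α × β))
  | [] => do
      Timed.tick
      pure []
  | [e] => do
      Timed.tick
      f e.2
  | e :: e' :: l => do
      Timed.tick
      if x ≤ e.1 then do
        let r ← f e.2
        Timed.ticks r.length
        pure (r ++ e' :: l)
      else do
        let r ← insertChildren x f (e' :: l)
        pure (e :: r)

/-- Insertion into a subtree; the result is the list of the one or two subtrees of the same height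
that replace it. -/
def insert {α : Type} [LinearOrder α] (t : ℕ) (x : α) :
    (h : ℕ) → BSub α h → Timed (List (α × BSub α h))
  | 0, (y : α) => do
      Timed.tick
      if x < y then pure [(x, x), (y, y)]
      else if x = y then pure [(y, y)]
      else pure [(y, y), (x, x)]
  | h + 1, (v : BNode α (BSub α h)) => do
      let l ← insertChildren x (insert t x h) v.children
      regroup t l

/-- Apply `f` to the first child whose largest element is at least `x`, if there is one; the result
replaces the child. -/
def deleteChildren {α β : Type} [LinearOrder α] (x : α) (f : β → Timed (List (α × β))) :
    List (α × β) → Timed (List (α × β))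
  | [] => do
      Timed.tick
      pure []
  | e :: l => do
      Timed.tick
      if x ≤ e.1 then do
        let r ← f e.2
        Timed.ticks r.length
        pure (r ++ l)
      else do
        let r ← deleteChildren x f l
        pure (e :: r)

/-- Repair a list of internal nodes in which one node may have fewer than `t` children: it is
merged with a neighbour, and the merged node is divided again if it is too large. -/
def rebalanceNodes {α : Type} (t : ℕ) {h : ℕ} :
    List (α × BNode α (BSub α h)) → Timed (List (α × BNode α (BSub α h)))
  | [] => do
      Timed.tick
      pure []
  | [e] => do
      Timed.tick
      pure [e]
  | e :: e' :: l => do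
      Timed.ticks (1 + e.2.children.length + e'.2.children.length)
      if e.2.children.length < t ∨ e'.2.children.length < t then do
        let r : List (α × BNode α (BSub α h)) ← regroup t (e.2.children ++ e'.2.children)
        Timed.ticks r.length
        pure (r ++ l)
      else do
        let r ← rebalanceNodes t (e' :: l)
        pure (e :: r)

/-- Repair a list of subtrees of height `h` (there is nothing to do for leaves). -/
def rebalance {α : Type} (t : ℕ) :
    (h : ℕ) → List (α × BSub α h) → Timed (List (α × BSub α h))
  | 0, l => pure l
  | _ + 1, l => rebalanceNodes t l

/-- Deletion from a subtree; the result is empty or holds the one subtree that replaces it, whose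
top node may have too few children. -/
def delete {α : Type} [LinearOrder α] (t : ℕ) (x : α) :
    (h : ℕ) → BSub α h → Timed (List (α × BSub α h))
  | 0, (y : α) => do
      Timed.tick
      if x = y then pure [] else pure [(y, y)]
  | h + 1, (v : BNode α (BSub α h)) => do
      let l ← deleteChildren x (delete t x h) v.children
      let l' ← rebalance t h l
      pack l'

/-- The child whose interval contains `i`, when the integers from `1` on are divided into
consecutive intervals, one for each child, of lengths the leaf counts of the children. -/
def pick {α : Type} {h : ℕ} : ℕ → List (α × BSub α h) → Timed (Option (BSub α h))
  | _, [] => do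
      Timed.tick
      pure none
  | i, e :: l => do
      Timed.tick
      if i ≤ count h e.2 then pure (some e.2) else pick (i - count h e.2) l

/-- Random descent to a leaf. -/
noncomputable def rand {α : Type} : (h : ℕ) → BSub α h → RTimed (Option α)
  | 0, (x : α) => do
      RTimed.lift Timed.tick
      pure (some x)
  | h + 1, (v : BNode α (BSub α h)) => do
      RTimed.lift (Timed.ticks (1 + v.children.length))
      let i ← RTimed.uniformIcc (v.children.map fun e => count h e.2).sum
      let c ← RTimed.lift (pick i v.children)
      match c with
      | none => pure none
      | some s => rand h s

end BSub

/-- A tree is empty or has a root of some height. -/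
inductive BTree (α : Type) : Type
  | empty : BTree α
  | tree (h : ℕ) (root : BSub α h) : BTree α

namespace BTree

/-- `T` is a B-tree of minimum degree `t`: the root, if it is internal, has between `2` and `2 * t`
children, all other internal nodes have between `t` and `2 * t` children, the stored data are
correct, and the leaves are in strictly increasing order from left to right. -/
def IsBTree {α : Type} [LinearOrder α] (t : ℕ) : BTree α → Prop
  | empty => True
  | tree h r => BSub.WF t 2 h r ∧ (BSub.leaves h r).Pairwise (· < ·)

/-- The set that is stored in the tree. -/
def elems {α : Type} [LinearOrder α] : BTree α → Finset α
  | empty => ∅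
  | tree h r => (BSub.leaves h r).toFinset

/-- The number of leaves that is stored at the root. -/
def size {α : Type} : BTree α → Timed ℕ
  | empty => do
      Timed.tick
      pure 0
  | tree h r => do
      Timed.tick
      pure (BSub.count h r)

/-- Membership query. -/
def query {α : Type} [LinearOrder α] (x : α) : BTree α → Timed Bool
  | empty => do
      Timed.tick
      pure false
  | tree h r => BSub.query x h r

/-- The tree with the given list of subtrees below its root; a root with one child is dropped. -/
def ofList {α : Type} {h : ℕ} : List (α × BSub α h) → Timed (BTree α)
  | [] => do
      Timed.tick
      pure empty
  | [e] => do
      Timed.tick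
      pure (tree h e.2)
  | e :: e' :: l => do
      let r ← BSub.pack (e :: e' :: l)
      match r with
      | [] => pure empty
      | e'' :: _ => pure (tree (h + 1) e''.2)

/-- Insertion. -/
def insert {α : Type} [LinearOrder α] (t : ℕ) (x : α) : BTree α → Timed (BTree α)
  | empty => do
      Timed.tick
      pure (tree 0 x)
  | tree h r => do
      let l ← BSub.insert t x h r
      ofList l

/-- Replace a root with a single child by this child. -/
def collapse {α : Type} : (h : ℕ) → BSub α h → Timed (BTree α)
  | 0, r => do
      Timed.tick
      pure (tree 0 r)
  | h + 1, (v : BNode α (BSub α h)) => do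
      Timed.tick
      match v.children with
      | [e] => pure (tree h e.2)
      | _ => pure (tree (h + 1) v)

/-- Deletion. -/
def delete {α : Type} [LinearOrder α] (t : ℕ) (x : α) : BTree α → Timed (BTree α)
  | empty => do
      Timed.tick
      pure empty
  | tree h r => do
      let l ← BSub.delete t x h r
      match l with
      | [] => pure empty
      | e :: _ => collapse h e.2

/-- A random element of the stored set (`none` for the empty tree). -/
noncomputable def rand {α : Type} : BTree α → RTimed (Option α)
  | empty => do
      RTimed.lift Timed.tick
      pure none
  | tree h r => BSub.rand h r

end BTree

/-! ## The greedy algorithm with one round of random samples -/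

namespace MaxCover

/-- The pair of `n.choose k` and `∑ i ≤ k, n.choose i`, the latter being the number of subsets of
size at most `k` of a set with `n` elements. -/
def chooseSum (n : ℕ) : ℕ → Timed (ℕ × ℕ)
  | 0 => do
      Timed.tick
      pure (1, 1)
  | k + 1 => do
      let p ← chooseSum n k
      Timed.tick
      pure (p.1 * (n - k) / (k + 1), p.2 + p.1 * (n - k) / (k + 1))

/-- The accuracy `ξ = min (ε η / (4 e k)) ε` with `η = e ^ (-1/4)`. -/
noncomputable def accuracy (ε : ℝ) (k : ℕ) : ℝ :=
  min (ε * Real.exp (-(1 / 4)) / (4 * Real.exp 1 * k)) ε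

/-- The number of samples for each set: the least natural number `w` with
`exp (-(ε' / 3) ^ 2 / 2) ^ w ≤ γ' / 4`, where `ε' = ξ / (4 k)` and `γ'` is `γ` divided by `n` times
the number of subsets of size at most `k` of the index set. -/
noncomputable def sampleCount (ε γ : ℝ) (k n : ℕ) : Timed ℕ := do
  let p ← chooseSum n k
  Timed.tick
  let ε' : ℝ := accuracy ε k / (4 * k)
  let γ' : ℝ := γ / (n * p.2)
  pure ⌈18 / ε' ^ 2 * Real.log (4 / γ')⌉₊

/-- An input set during a run: its index, its tree, its size and the list of its samples, each of
which is white (`false`) or black (`true`). -/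
structure Item (n : ℕ) (α : Type) where
  idx : Fin n
  tree : BTree α
  size : ℕ
  samples : List (α × Bool)

/-- `w` independent random elements of the stored set, all of them white (an empty set has no
samples). -/
noncomputable def randomSamples {α : Type} (T : BTree α) : ℕ → RTimed (List (α × Bool))
  | 0 => do
      RTimed.lift Timed.tick
      pure []
  | w + 1 => do
      RTimed.lift Timed.tick
      let x ← T.rand
      let R ← randomSamples T w
      match x with
      | none => pure R
      | some a => pure ((a, false) :: R)

/-- Read the size of each set and draw its samples. -/
noncomputable def initItems {α : Type} {n : ℕ} (A : Fin n → BTree α) (w : ℕ) :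
    List (Fin n) → RTimed (List (Item n α))
  | [] => do
      RTimed.lift Timed.tick
      pure []
  | i :: l => do
      RTimed.lift Timed.tick
      let s ← RTimed.lift (A i).size
      let R ← randomSamples (A i) w
      let r ← initItems A w l
      pure (⟨i, A i, s, R⟩ :: r)

/-- Mark the samples that belong to the set stored in `B` black. -/
def markSamples {α : Type} [LinearOrder α] (B : BTree α) :
    List (α × Bool) → Timed (List (α × Bool))
  | [] => do
      Timed.tick
      pure []
  | a :: R => do
      Timed.tick
      let q ← B.query a.1
      let r ← markSamples B R
      pure ((a.1, a.2 || q) :: r)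

/-- The number of white samples. -/
def countWhite {α : Type} : List (α × Bool) → Timed ℕ
  | [] => do
      Timed.tick
      pure 0
  | a :: R => do
      Timed.tick
      let r ← countWhite R
      pure (if a.2 then r else r + 1)

/-- Update the samples with the newly picked set, which is the first one of the list `L'` of picked
sets (there is none in the first round). -/
def updateSamples {α : Type} [LinearOrder α] (L' : List (BTree α)) (R : List (α × Bool)) :
    Timed (List (α × Bool)) := do
  Timed.tick
  match L' with
  | [] => pure R
  | B :: _ => markSamples B R

/-- One pass over the remaining sets: update the samples, estimate the number of new elements of
each set, and keep the first set with the largest estimate. -/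
def scan {α : Type} [LinearOrder α] {n : ℕ} (w : ℕ) (L' : List (BTree α)) :
    List (Item n α) → ℚ × Option (Item n α) →
      Timed (List (Item n α) × (ℚ × Option (Item n α)))
  | [], best => do
      Timed.tick
      pure ([], best)
  | a :: l, best => do
      Timed.tick
      let R ← updateSamples L' a.samples
      let r ← countWhite R
      let a' : Item n α := ⟨a.idx, a.tree, a.size, R⟩
      let s : ℚ := (r : ℚ) / (w : ℚ) * (a.size : ℚ)
      let p ← scan w L' l (if best.1 < s then (s, some a') else best)
      pure (a' :: p.1, p.2)

/-- Remove the set with index `i`. -/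
def removeItem {α : Type} {n : ℕ} (i : Fin n) : List (Item n α) → Timed (List (Item n α))
  | [] => do
      Timed.tick
      pure []
  | a :: l => do
      Timed.tick
      if a.idx = i then pure l
      else do
        let r ← removeItem i l
        pure (a :: r)

/-- The given number of rounds of the greedy algorithm, with the remaining sets `L`, the picked
sets `L'` (the newest one first), the current estimate `z` and the list `H` of picked indices. -/
def greedy {α : Type} [LinearOrder α] {n : ℕ} (w : ℕ) :
    ℕ → List (Item n α) → List (BTree α) → ℚ → List (Fin n) → Timed (ℚ × List (Fin n))
  | 0, _, _, z, H => do
      Timed.tick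
      pure (z, H)
  | j + 1, L, L', z, H => do
      Timed.tick
      let p ← scan w L' L (-1, none)
      match p.2.2 with
      | none => pure (z, H)
      | some a => do
          let L₁ ← removeItem a.idx p.1
          greedy w j L₁ (a.tree :: L') (z + p.2.1) (a.idx :: H)

/-- The algorithm: it returns an estimate `z` of the size of the union, and the picked indices. -/
noncomputable def approximateMaximumCover {α : Type} [LinearOrder α] {n : ℕ}
    (A : Fin n → BTree α) (k : ℕ) (ε γ : ℝ) : RTimed (ℚ × List (Fin n)) := do
  let w ← RTimed.lift (sampleCount ε γ k n)
  let L ← initItems A w (List.finRange n)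
  RTimed.lift (greedy w k L [] 0 [])

/-- The number of elements covered by the sets with index in `H`. -/
def coverage {α : Type} [LinearOrder α] {n : ℕ} (A : Fin n → Finset α) (H : Finset (Fin n)) : ℕ :=
  (H.biUnion A).card

/-- The maximum coverage `C*` by `k` of the sets. -/
def optimum {α : Type} [LinearOrder α] {n : ℕ} (A : Fin n → Finset α) (k : ℕ) : ℕ :=
  ((Finset.univ : Finset (Fin n)).powersetCard k).sup (coverage A)

/-- The largest size of the sets. -/
def maxSize {α : Type} {n : ℕ} (A : Fin n → Finset α) : ℕ :=
  Finset.univ.sup fun i => (A i).card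

/-- The bound on the number of steps when samples and queries cost one step. -/
noncomputable def boundT (ε γ : ℝ) (k n : ℕ) : ℝ :=
  (k : ℝ) ^ 5 / ε ^ 2 * (k * Real.log (3 * n / k) + Real.log (1 / γ)) * n

/-- The bound on the number of samples. -/
noncomputable def boundR (ε γ : ℝ) (k n : ℕ) : ℝ :=
  (k : ℝ) ^ 4 / ε ^ 2 * (k * Real.log (3 * n / k) + Real.log (1 / γ)) * n

/-- The bound on the number of queries. -/
noncomputable def boundQ (ε γ : ℝ) (k n : ℕ) : ℝ :=
  (k : ℝ) ^ 5 / ε ^ 2 * (k * Real.log (3 * n / k) + Real.log (1 / γ)) * n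

end MaxCover

/-! The B-tree part rests on two facts. Every internal node has at least two children, so a tree of
height `h` has at least `2 ^ h` leaves, and an operation whose cost per level depends only on `t` is
logarithmic (`two_pow_le_length`). Each update changes one child per level and disturbs the degrees
only slightly: insertion can leave `2 * t + 1` children, which are split in two; deletion can leave
one child node with `t - 1` children, which is merged with a neighbour and split again if needed.
The random descent is uniform because a child is chosen with weight equal to its leaf count, and
these weights cancel against the probabilities inside the child (`BSub.expect_rand`).

The difficulty in the covering part is that one batch of samples serves all rounds, so the covered
set depends on the samples used to estimate its complement. The remedy is a union bound over every
union of at most `k` input sets (`expect_exists_deviates_le`). For a fixed set `U`, a Chernoff bound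
shows that the estimate of `|A_i \ U|` errs by more than `d * |A_i|` with probability at most `2 *
exp (-(d ^ 2 / 4 * w))`, where `d = ξ / (8 * k) = ε' / 2`. The chosen `w` makes the total failure
probability less than `γ` (`exp_sampleCount_le`).

On the good event the run is deterministic and every estimate is within `D = d * M`, with `M` the
largest set size. Each pick is then within `2 * D` of the best gain, so the deficit to the optimum
`O` contracts by `1 - 1 / k` up to an added `2 * D` (`GreedyInv.cons`). After `k` rounds the
accumulated error is at most `ξ * M / 4`. It is paid for by the slack in `(1 - 1 / k) ^ k ≤ (1 / e)
* (1 - 1 / (4 * k))` (`one_sub_inv_pow_le`), since `M ≤ O`. The estimate `z` has absolute error at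
most `k * D`, which becomes a relative error because the first pick already nearly attains `M`. -/

namespace Timed

@[simp] theorem pure_val {β : Type} (b : β) : (pure b : Timed β).val = b := rfl
@[simp] theorem pure_time {β : Type} (b : β) : (pure b : Timed β).time = 0 := rfl
@[simp] theorem bind_val {β δ : Type} (x : Timed β) (f : β → Timed δ) :
    (x >>= f).val = (f x.val).val := rfl
@[simp] theorem bind_time {β δ : Type} (x : Timed β) (f : β → Timed δ) :
    (x >>= f).time = x.time + (f x.val).time := rfl
@[simp] theorem ticks_time (c : ℕ) : (ticks c).time = c := rfl
@[simp] theorem tick_time : tick.time = 1 := rfl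

end Timed

/-! ### Expectations and possible outcomes of randomized programs -/

namespace RTimed

open scoped ENNReal

/-- The expectation of a function of the result. -/
noncomputable def expect {β : Type} (p : RTimed β) (f : β → ℝ≥0∞) : ℝ≥0∞ :=
  ∑' x : Timed β, (show PMF (Timed β) from p) x * f x.val

theorem pmf_pure_tsum {β : Type} (a : β) (f : β → ℝ≥0∞) :
    ∑' x, PMF.pure a x * f x = f a := by
  classical
  rw [tsum_eq_single a]
  · simp
  · intro b hb
    simp [PMF.pure_apply, hb]

theorem pmf_bind_tsum {β δ : Type} (p : PMF β) (q : β → PMF δ) (f : δ → ℝ≥0∞) :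
    ∑' y, p.bind q y * f y = ∑' x, p x * ∑' y, q x y * f y := by
  simp_rw [PMF.bind_apply, ← ENNReal.tsum_mul_right, ← ENNReal.tsum_mul_left]
  rw [ENNReal.tsum_comm]
  simp_rw [mul_assoc]

theorem pmf_map_tsum {β δ : Type} (p : PMF β) (g : β → δ) (f : δ → ℝ≥0∞) :
    ∑' y, p.map g y * f y = ∑' x, p x * f (g x) := by
  rw [PMF.map, pmf_bind_tsum]
  simp_rw [Function.comp_apply, pmf_pure_tsum]

@[simp] theorem expect_pure {β : Type} (b : β) (f : β → ℝ≥0∞) :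
    expect (pure b : RTimed β) f = f b :=
  pmf_pure_tsum (⟨b, 0⟩ : Timed β) fun x => f x.val

@[simp] theorem expect_lift {β : Type} (x : Timed β) (f : β → ℝ≥0∞) :
    expect (lift x) f = f x.val :=
  pmf_pure_tsum x fun x => f x.val

-- The integrand sees only `val`, so the shift of the step counter drops out and the tower rule
-- remains.
@[simp] theorem expect_bind {β δ : Type} (p : RTimed β) (q : β → RTimed δ) (f : δ → ℝ≥0∞) :
    expect (p >>= q) f = expect p fun b => expect (q b) f := by
  refine (pmf_bind_tsum (β := Timed β) p _ (fun x : Timed δ => f x.val)).trans ?_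
  refine tsum_congr fun x => congrArg _ ?_
  exact pmf_map_tsum (β := Timed δ) (q x.val) (fun b => (⟨b.val, x.time + b.time⟩ : Timed δ))
    (fun x => f x.val)

/-- This is how facts that hold in every possible run, such as the length of a sample list, enter
bounds on expectations. -/
theorem expect_mono_of_outcomes {β : Type} {p : RTimed β} {f g : β → ℝ≥0∞}
    (h : ∀ o ∈ p.outcomes, f o.val ≤ g o.val) : expect p f ≤ expect p g := by
  refine ENNReal.tsum_le_tsum fun x => ?_
  by_cases hx : x ∈ p.outcomes
  · gcongr
    exact h x hx
  · have : (show PMF (Timed β) from p) x = 0 := (PMF.apply_eq_zero_iff _ _).2 hx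
    simp [this]

theorem expect_mono {β : Type} (p : RTimed β) {f g : β → ℝ≥0∞}
    (h : ∀ b, f b ≤ g b) : expect p f ≤ expect p g :=
  expect_mono_of_outcomes fun _ _ => h _

@[simp] theorem expect_const {β : Type} (p : RTimed β) (c : ℝ≥0∞) :
    expect p (fun _ => c) = c := by
  rw [expect, ENNReal.tsum_mul_right, PMF.tsum_coe, one_mul]

theorem expect_add {β : Type} (p : RTimed β) (f g : β → ℝ≥0∞) :
    expect p (fun b => f b + g b) = expect p f + expect p g := by
  simp_rw [expect, mul_add, ENNReal.tsum_add]

theorem expect_mul_left {β : Type} (p : RTimed β) (c : ℝ≥0∞) (f : β → ℝ≥0∞) :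
    expect p (fun b => c * f b) = c * expect p f := by
  simp_rw [expect, ← ENNReal.tsum_mul_left, mul_left_comm]

theorem expect_finset_sum {β ι : Type} (p : RTimed β) (s : Finset ι) (f : ι → β → ℝ≥0∞) :
    expect p (fun b => ∑ i ∈ s, f i b) = ∑ i ∈ s, expect p (f i) := by
  classical
  induction s using Finset.induction_on with
  | empty => simp
  | insert a s ha ih => simp_rw [Finset.sum_insert ha, expect_add, ih]

open Classical in
theorem prob_eq_expect {β : Type} (p : RTimed β) (P : β → Prop) :
    p.prob P = expect p fun b => if P b then 1 else 0 := by
  rw [prob, PMF.toOuterMeasure_apply, expect, ← pmf_map_tsum (β := Timed β) p Timed.val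
    (fun b => if P b then 1 else 0)]
  refine tsum_congr fun b => ?_
  by_cases h : P b <;> simp [Set.indicator, h, law]

open Classical in
theorem law_apply_eq_expect {β : Type} (p : RTimed β) (b : β) :
    p.law b = expect p fun c => if c = b then 1 else 0 := by
  rw [expect, ← pmf_map_tsum (β := Timed β) p Timed.val (fun c => if c = b then 1 else 0),
    tsum_eq_single b]
  · simp [law]
  · intro c hc
    simp [hc]

theorem uniformIcc_of_pos {c : ℕ} (hc : 0 < c) :
    uniformIcc c = PMF.map (fun i => (⟨i, 1⟩ : Timed ℕ))
      (PMF.uniformOfFinset (Finset.Icc 1 c) (Finset.nonempty_Icc.2 hc)) :=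
  dif_pos (Finset.nonempty_Icc.2 hc)

theorem expect_uniformIcc {c : ℕ} (hc : 0 < c) (f : ℕ → ℝ≥0∞) :
    expect (uniformIcc c) f = (∑ i ∈ Finset.Icc 1 c, f i) / c := by
  rw [uniformIcc_of_pos hc]
  refine (pmf_map_tsum (PMF.uniformOfFinset (Finset.Icc 1 c) _) (fun i => (⟨i, 1⟩ : Timed ℕ))
    (fun x => f x.val)).trans ?_
  rw [tsum_eq_sum (s := Finset.Icc 1 c), ENNReal.div_eq_inv_mul, Finset.mul_sum]
  · refine Finset.sum_congr rfl fun i hi => ?_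
    rw [PMF.uniformOfFinset_apply_of_mem _ hi]
    simp
  · intro i hi
    rw [PMF.uniformOfFinset_apply_of_notMem _ hi, zero_mul]

@[simp] theorem mem_outcomes_pure {β : Type} {b : β} {o : Timed β} :
    o ∈ (pure b : RTimed β).outcomes ↔ o = ⟨b, 0⟩ := by
  change o ∈ (PMF.pure (⟨b, 0⟩ : Timed β)).support ↔ _
  simp

@[simp] theorem mem_outcomes_lift {β : Type} {x o : Timed β} :
    o ∈ (lift x).outcomes ↔ o = x := by
  change o ∈ (PMF.pure x).support ↔ _
  simp

theorem mem_outcomes_bind {β δ : Type} {p : RTimed β} {q : β → RTimed δ} {o : Timed δ} :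
    o ∈ (p >>= q).outcomes ↔
      ∃ a ∈ p.outcomes, ∃ b ∈ (q a.val).outcomes, o = ⟨b.val, a.time + b.time⟩ := by
  refine (PMF.mem_support_bind_iff (α := Timed β) p _ o).trans ?_
  refine exists_congr fun a => and_congr_right fun _ => ?_
  refine (PMF.mem_support_map_iff (α := Timed δ) _ (q a.val) o).trans ?_
  exact exists_congr fun b => and_congr_right fun _ => eq_comm

@[simp] theorem mem_outcomes_lift_bind {β δ : Type} {x : Timed β} {q : β → RTimed δ}
    {o : Timed δ} : o ∈ (lift x >>= q).outcomes ↔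
      ∃ b ∈ (q x.val).outcomes, o = ⟨b.val, x.time + b.time⟩ := by
  simp [mem_outcomes_bind]

theorem mem_outcomes_uniformIcc {c : ℕ} (hc : 0 < c) {o : Timed ℕ}
    (h : o ∈ (uniformIcc c).outcomes) : o.time = 1 ∧ 1 ≤ o.val ∧ o.val ≤ c := by
  rw [uniformIcc_of_pos hc] at h
  obtain ⟨i, hi, rfl⟩ := (PMF.mem_support_map_iff _ _ _).1 h
  rw [PMF.mem_support_uniformOfFinset_iff, Finset.mem_Icc] at hi
  exact ⟨rfl, hi⟩

end RTimed

/-! ### Building nodes, and the invariants of subtrees -/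

namespace BSub

/-- The elements in the leaves of a list of subtrees. -/
def flat {α : Type} {h : ℕ} (l : List (α × BSub α h)) : List α :=
  l.flatMap fun e => leaves h e.2

/-- A subtree that satisfies the structural invariants, with its largest element. -/
def Good {α : Type} [LinearOrder α] (t lo : ℕ) {h : ℕ} (e : α × BSub α h) : Prop :=
  IsGreatest {y | y ∈ leaves h e.2} e.1 ∧ WF t lo h e.2

variable {α : Type}

@[simp] theorem flat_nil {h : ℕ} : flat ([] : List (α × BSub α h)) = [] := rfl

@[simp] theorem flat_cons {h : ℕ} (e : α × BSub α h) (l : List (α × BSub α h)) :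
    flat (e :: l) = leaves h e.2 ++ flat l := rfl

@[simp] theorem flat_append {h : ℕ} (l l' : List (α × BSub α h)) :
    flat (l ++ l') = flat l ++ flat l' := List.flatMap_append

theorem pack_length_le {h : ℕ} (l : List (α × BSub α h)) : (pack l).val.length ≤ 1 := by
  unfold pack
  cases l.getLast? <;> simp

theorem pack_time {h : ℕ} (l : List (α × BSub α h)) : (pack l).time = 1 + l.length := by
  unfold pack
  cases l.getLast? <;> simp

theorem regroup_length_le {t : ℕ} {h : ℕ} (l : List (α × BSub α h)) : (regroup t l).val.length ≤ 2 := by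
  unfold regroup
  have h0 := pack_length_le l
  have h1 := pack_length_le (l.take (l.length / 2))
  have h2 := pack_length_le (l.drop (l.length / 2))
  split_ifs
  · simp only [Timed.bind_val]; lia
  · simp only [Timed.bind_val, Timed.pure_val, List.length_append]; lia

theorem regroup_time {t : ℕ} {h : ℕ} (l : List (α × BSub α h)) : (regroup t l).time ≤ 4 + 3 * l.length := by
  unfold regroup
  split_ifs <;> simp [pack_time] <;> lia

variable [LinearOrder α] {t lo lo' h : ℕ}

theorem wf_succ {v : BNode α (BSub α h)} :
    WF t lo (h + 1) v ↔ lo ≤ v.children.length ∧ v.children.length ≤ 2 * t ∧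
      v.count = (flat v.children).length ∧ ∀ e ∈ v.children, Good t t e := Iff.rfl

theorem WF.mono {s : BSub α h} (hs : WF t lo h s) (hl : lo' ≤ lo) : WF t lo' h s := by
  cases h with
  | zero => trivial
  | succ h => exact ⟨hl.trans hs.1, hs.2⟩

theorem Good.mono {e : α × BSub α h} (he : Good t lo e) (hl : lo' ≤ lo) : Good t lo' e :=
  ⟨he.1, he.2.mono hl⟩

theorem WF.count_eq {s : BSub α h} (hs : WF t lo h s) : count h s = (leaves h s).length := by
  cases h with
  | zero => rfl
  | succ h => exact hs.2.2.1

theorem sum_count {l : List (α × BSub α h)} (hl : ∀ e ∈ l, Good t lo e) :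
    (l.map fun e => count h e.2).sum = (flat l).length := by
  induction l with
  | nil => rfl
  | cons e l ih =>
    rw [List.forall_mem_cons] at hl
    simp [ih hl.2, hl.1.2.count_eq]

/-- By sortedness the last child dominates all earlier ones, so `pack` need only look at the last
entry. -/
theorem isGreatest_flat {l : List (α × BSub α h)} {e : α × BSub α h}
    (hl : ∀ e ∈ l, Good t lo e) (hs : (flat l).Pairwise (· < ·)) (he : l.getLast? = some e) :
    IsGreatest {y | y ∈ flat l} e.1 := by
  obtain ⟨l', rfl⟩ := List.getLast?_eq_some_iff.1 he
  have hg := (hl e (by simp)).1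
  simp only [flat_append, flat_cons, flat_nil, List.append_nil] at hs ⊢
  refine ⟨List.mem_append_right _ hg.1, fun y hy => ?_⟩
  rcases List.mem_append.1 hy with hy | hy
  · exact ((List.pairwise_append.1 hs).2.2 y hy _ hg.1).le
  · exact hg.2 hy

theorem pack_spec {l : List (α × BSub α h)} (h0 : l ≠ []) (h1 : lo ≤ l.length)
    (h2 : l.length ≤ 2 * t) (hl : ∀ e ∈ l, Good t t e) (hs : (flat l).Pairwise (· < ·)) :
    (∃ e, (pack l).val = [e]) ∧ (∀ e ∈ (pack l).val, Good t lo e) ∧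
      flat (pack l).val = flat l := by
  obtain ⟨e, he⟩ : ∃ e, l.getLast? = some e := ⟨_, List.getLast?_eq_some_getLast h0⟩
  have hp : (pack l).val =
      [(e.1, (⟨(l.map fun e => count h e.2).sum, l⟩ : BNode α (BSub α h)))] := by
    unfold pack
    rw [he]
    rfl
  rw [hp]
  refine ⟨⟨_, rfl⟩, ?_, ?_⟩
  · intro e' he'
    obtain rfl := List.mem_singleton.1 he'
    exact ⟨isGreatest_flat hl hs he, wf_succ.2 ⟨h1, h2, sum_count hl, hl⟩⟩
  · exact List.append_nil _

/-- A list that is split has between `2 * t + 1` and `4 * t` entries, so each half has between `t`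
and `2 * t`. Only a node that was not split can have fewer than `t` children; the last clause
records this for a root that splits. -/
theorem regroup_spec {l : List (α × BSub α h)} (h0 : l ≠ []) (hlo : lo ≤ t) (h1 : lo ≤ l.length)
    (h2 : l.length ≤ 4 * t) (hl : ∀ e ∈ l, Good t t e) (hs : (flat l).Pairwise (· < ·)) :
    1 ≤ (regroup t l).val.length ∧ (∀ e ∈ (regroup t l).val, Good t lo e) ∧
      flat (regroup t l).val = flat l ∧
      ((regroup t l).val.length ≠ 1 → ∀ e ∈ (regroup t l).val, Good t t e) := by
  unfold regroup
  split_ifs with hc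
  · simp only [Timed.bind_val]
    obtain ⟨⟨e, he⟩, h3, h4⟩ := pack_spec h0 h1 hc hl hs
    refine ⟨?_, h3, h4, fun h => absurd ?_ h⟩ <;> simp [he]
  · simp only [Timed.bind_val, Timed.pure_val]
    have hs' := hs
    rw [← List.take_append_drop (l.length / 2) l, flat_append, List.pairwise_append] at hs'
    obtain ⟨⟨a, ha⟩, ha1, ha2⟩ := pack_spec (lo := t) (l := l.take (l.length / 2))
      (by rw [← List.length_pos_iff, List.length_take]; lia)
      (by rw [List.length_take]; lia) (by rw [List.length_take]; lia)
      (fun e he => hl e (List.mem_of_mem_take he)) hs'.1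
    obtain ⟨⟨b, hb⟩, hb1, hb2⟩ := pack_spec (lo := t) (l := l.drop (l.length / 2))
      (by rw [← List.length_pos_iff, List.length_drop]; lia)
      (by rw [List.length_drop]; lia) (by rw [List.length_drop]; lia)
      (fun e he => hl e (List.mem_of_mem_drop he)) hs'.2.1
    have hg : ∀ e ∈ (pack (l.take (l.length / 2))).val ++ (pack (l.drop (l.length / 2))).val,
        Good t t e := by
      intro e he
      rcases List.mem_append.1 he with he | he
      exacts [ha1 e he, hb1 e he]
    refine ⟨by simp [ha], fun e he => (hg e he).mono hlo, ?_, fun _ => hg⟩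
    rw [flat_append, ha2, hb2, ← flat_append, List.take_append_drop]

/-! ### Queries -/

theorem query_time {s : BSub α h} (x : α) (hs : WF t lo h s) :
    (query x h s).time ≤ (h + 1) * (2 * t + 1) := by
  have key : ∀ {β : Type} (l : List (α × β)), (findChild x l).time ≤ l.length + 1 := by
    intro β l
    induction l with
    | nil => simp [findChild]
    | cons e l ih =>
      unfold findChild
      split_ifs <;> simp; lia
  have key2 : ∀ {β : Type} (l : List (α × β)) s, (findChild x l).val = some s →
      ∃ e ∈ l, e.2 = s := by
    intro β l s hs
    induction l with
    | nil => simp [findChild] at hs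
    | cons e l ih =>
      unfold findChild at hs
      split_ifs at hs
      · simp only [Timed.bind_val, Timed.pure_val, Option.some.injEq] at hs
        exact ⟨e, by simp, hs⟩
      · obtain ⟨e', he', h⟩ := ih hs
        exact ⟨e', by simp [he'], h⟩
  induction h generalizing lo with
  | zero => change 1 ≤ _; lia
  | succ h ih =>
    obtain ⟨-, h2, -, h4⟩ := wf_succ.1 hs
    have hk := key (s : BNode α (BSub α h)).children
    simp only [query, Timed.bind_time]
    cases hc : (findChild x (s : BNode α (BSub α h)).children).val with
    | none =>
      simp only [Timed.pure_time]
      nlinarith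
    | some c =>
      obtain ⟨e, he, rfl⟩ := key2 _ _ hc
      have := ih (h4 e he).2
      simp only
      nlinarith

/-- Only the first child whose maximum is at least `x` can hold `x`: earlier maxima are too small,
and sortedness puts all later leaves strictly above `x`. -/
theorem query_val {s : BSub α h} (x : α) (hs : WF t lo h s)
    (hp : (leaves h s).Pairwise (· < ·)) :
    (query x h s).val = true ↔ x ∈ leaves h s := by
  induction h generalizing lo with
  | zero =>
    -- `BSub α 0` is `α` only by unfolding, so the leaf case is stated for `y : α` and applied to
    -- `s`; the same device recurs for the other operations.
    have key : ∀ y : α, decide (x = y) = true ↔ x ∈ [y] := by simp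
    exact key s
  | succ h ih =>
    obtain ⟨-, -, -, h4⟩ := wf_succ.1 hs
    have key : ∀ l : List (α × BSub α h), (∀ e ∈ l, Good t t e) → (flat l).Pairwise (· < ·) →
        ((match (findChild x l).val with
          | none => (pure false : Timed Bool)
          | some s => query x h s).val = true ↔ x ∈ flat l) := by
      intro l hl hp
      induction l with
      | nil => simp [findChild]
      | cons e l ih' =>
        rw [List.forall_mem_cons] at hl
        rw [flat_cons, List.pairwise_append] at hp
        rw [flat_cons, List.mem_append]
        unfold findChild
        split_ifs with hx
        · simp only [Timed.bind_val, Timed.pure_val]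
          rw [ih hl.1.2 hp.1]
          refine ⟨Or.inl, fun h => h.resolve_right fun h => ?_⟩
          exact absurd (hp.2.2 _ hl.1.1.1 _ h) (not_lt.2 hx)
        · simp only [Timed.bind_val]
          rw [ih' hl.2 hp.2.1]
          refine ⟨Or.inr, fun h => h.resolve_left fun h => hx (hl.1.1.2 h)⟩
    exact key _ h4 hp

end BSub

/-! ### Insertion into a subtree -/

namespace BSub

/-- `r` is a nonempty list of subtrees that stores the elements of `old` and `x`, in increasing
order. -/
structure InsertSpec {α : Type} [LinearOrder α] (t lo : ℕ) {h : ℕ} (x : α) (old : List α)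
    (r : List (α × BSub α h)) : Prop where
  pos : 1 ≤ r.length
  good : ∀ e ∈ r, Good t lo e
  sorted : (flat r).Pairwise (· < ·)
  mem : ∀ y, y ∈ flat r ↔ y = x ∨ y ∈ old

variable {α : Type} [LinearOrder α] {t lo h : ℕ}

theorem insertChildren_length_le {β : Type} (x : α) (f : β → Timed (List (α × β)))
    (hf : ∀ b, (f b).val.length ≤ 2) (l : List (α × β)) :
    (insertChildren x f l).val.length ≤ l.length + 1 := by
  fun_induction insertChildren x f l with
  | case1 => simp
  | case2 e => simpa using hf e.2
  | case3 e e' l ih =>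
    simp only [Timed.bind_val]
    split_ifs with hx
    · have := hf e.2
      simp only [Timed.bind_val, Timed.pure_val, List.length_append, List.length_cons]
      lia
    · simpa using ih

theorem insertChildren_time_le {β : Type} (x : α) (f : β → Timed (List (α × β)))
    (hf : ∀ b, (f b).val.length ≤ 2) {B : ℕ} (l : List (α × β))
    (hB : ∀ e ∈ l, (f e.2).time ≤ B) :
    (insertChildren x f l).time ≤ l.length + 3 + B := by
  fun_induction insertChildren x f l with
  | case1 => simp; lia
  | case2 e =>
    have := hB e (by simp)
    simp; lia
  | case3 e e' l ih =>
    simp only [Timed.bind_time]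
    split_ifs with hx
    · have := hf e.2
      have := hB e (by simp)
      simp; lia
    · have := ih fun a ha => hB a (List.mem_cons_of_mem _ ha)
      simp only [Timed.bind_time, Timed.pure_time, Timed.tick_time, List.length_cons] at this ⊢
      lia

/-- Children that are passed over have maxima below `x`, and leaves to the right of the chosen child
exceed its maximum, which is then at least `x`; hence order survives. The length claim keeps the
lower bound on the degree until regrouping. -/
theorem insertChildren_spec (x : α) (f : BSub α h → Timed (List (α × BSub α h)))
    (hf : ∀ e : α × BSub α h, Good t t e → (leaves h e.2).Pairwise (· < ·) →
      InsertSpec t t x (leaves h e.2) (f e.2).val)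
    (l : List (α × BSub α h)) (h0 : l ≠ []) (hl : ∀ e ∈ l, Good t t e)
    (hs : (flat l).Pairwise (· < ·)) :
    InsertSpec t t x (flat l) (insertChildren x f l).val ∧
      l.length ≤ (insertChildren x f l).val.length := by
  fun_induction insertChildren x f l with
  | case1 => exact absurd rfl h0
  | case2 e =>
    have := hf e (hl e (by simp)) (by simpa using hs)
    simp only [Timed.bind_val, flat_cons, flat_nil, List.append_nil]
    exact ⟨this, this.pos⟩
  | case3 e e' l ih =>
    simp only [Timed.bind_val]
    split_ifs with hx
    · simp only [Timed.bind_val, Timed.pure_val]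
      rw [flat_cons, List.pairwise_append] at hs
      rw [List.forall_mem_cons] at hl
      have := hf e hl.1 hs.1
      refine ⟨⟨?_, ?_, ?_, ?_⟩, ?_⟩
      · simp; lia
      · intro a ha
        rcases List.mem_append.1 ha with ha | ha
        exacts [this.good a ha, hl.2 a ha]
      · rw [flat_append, List.pairwise_append]
        refine ⟨this.sorted, hs.2.1, fun a ha b hb => ?_⟩
        rcases (this.mem a).1 ha with rfl | ha
        · exact hx.trans_lt (hs.2.2 _ hl.1.1.1 _ hb)
        · exact hs.2.2 _ ha _ hb
      · intro y
        simp only [flat_append, List.mem_append, this.mem, flat_cons, or_assoc]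
      · have := this.pos
        simp only [List.length_append, List.length_cons]
        lia
    · simp only [Timed.bind_val, Timed.pure_val]
      rw [flat_cons, List.pairwise_append] at hs
      rw [List.forall_mem_cons] at hl
      obtain ⟨h1, h2⟩ := ih (by simp) hl.2 hs.2.1
      refine ⟨⟨?_, ?_, ?_, ?_⟩, ?_⟩
      · simp
      · rw [List.forall_mem_cons]
        exact ⟨hl.1, h1.good⟩
      · rw [flat_cons, List.pairwise_append]
        refine ⟨hs.1, h1.sorted, fun a ha b hb => ?_⟩
        rcases (h1.mem b).1 hb with rfl | hb
        · exact (hl.1.1.2 ha).trans_lt (not_le.1 hx)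
        · exact hs.2.2 _ ha _ hb
      · intro y
        rw [flat_cons, List.mem_append, h1.mem, flat_cons (e := e), List.mem_append]
        tauto
      · simpa using h2

theorem insert_length_le (x : α) (s : BSub α h) : (insert t x h s).val.length ≤ 2 := by
  cases h with
  | zero =>
    have key : ∀ y : α, (insert t x 0 (y : BSub α 0)).val.length ≤ 2 := by
      intro y
      rw [insert]
      split_ifs <;> simp
    exact key s
  | succ h => exact regroup_length_le _

theorem good_leaf (a : α) : Good t lo (h := 0) (a, a) :=
  ⟨⟨List.mem_singleton.2 rfl, fun _ hy => (List.mem_singleton.1 hy).le⟩, trivial⟩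

/-- One level costs at most `2 * t + 3` for the walk and `4 + 3 * (2 * t + 1)` for regrouping, in
total `8 * t + 10`. -/
theorem insert_time_le (x : α) {s : BSub α h} (hs : WF t lo h s) :
    (insert t x h s).time ≤ (h + 1) * (8 * t + 10) := by
  induction h generalizing lo with
  | zero =>
    have key : ∀ y : α, (insert t x 0 (y : BSub α 0)).time ≤ 1 := by
      intro y
      rw [insert]
      split_ifs <;> exact le_rfl
    have := key s
    lia
  | succ h ih =>
    obtain ⟨h1, h2, -, h4⟩ := wf_succ.1 hs
    have k1 := insertChildren_time_le x (insert t x h) (insert_length_le x) _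
      fun e he => ih (h4 e he).2
    have k2 := insertChildren_length_le x (insert t x h) (insert_length_le x)
      (s : BNode α (BSub α h)).children
    have k3 := regroup_time (t := t)
      (insertChildren x (insert t x h) (s : BNode α (BSub α h)).children).val
    simp only [insert, Timed.bind_time]
    rw [Nat.succ_mul (h + 1)]
    lia

/-- The parameter `lo` is `2` at the root and `t` below it. When a root splits, its halves become
ordinary nodes and need degree at least `t`, which is what the second part provides. -/
theorem insert_spec (x : α) {s : BSub α h} (h1 : 1 ≤ lo) (h2 : lo ≤ t) (hs : WF t lo h s)
    (hp : (leaves h s).Pairwise (· < ·)) :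
    InsertSpec t lo x (leaves h s) (insert t x h s).val ∧
      ((insert t x h s).val.length ≠ 1 → ∀ e ∈ (insert t x h s).val, Good t t e) := by
  induction h generalizing lo with
  | zero =>
    have key : ∀ y : α, InsertSpec t lo x [y] (insert t x 0 (y : BSub α 0)).val ∧
        ∀ e ∈ (insert t x 0 (y : BSub α 0)).val, Good t t e := by
      intro y
      have hg : ∀ a : α, Good t t (h := 0) (a, a) := good_leaf
      have hf : ∀ a b : α, flat (h := 0) [(a, a), (b, b)] = [a, b] := fun a b => rfl
      have hf' : ∀ a : α, flat (h := 0) [(a, a)] = [a] := fun a => rfl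
      rw [insert]
      split_ifs with hxy hxy
      · have hgood : ∀ e ∈ ([(x, x), (y, y)] : List (α × BSub α 0)), Good t t e := by
          rw [List.forall_mem_cons, List.forall_mem_singleton]
          exact ⟨hg x, hg y⟩
        refine ⟨⟨by simp, fun e he => (hgood e he).mono h2, ?_, fun z => ?_⟩, hgood⟩
        · exact (hf x y).symm ▸ (by simpa using hxy)
        · exact (hf x y).symm ▸ (by simp)
      · have hgood : ∀ e ∈ ([(y, y)] : List (α × BSub α 0)), Good t t e := by
          rw [List.forall_mem_singleton]
          exact hg y
        refine ⟨⟨by simp, fun e he => (hgood e he).mono h2, ?_, fun z => ?_⟩, hgood⟩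
        · exact (hf' y).symm ▸ (by simp)
        · exact (hf' y).symm ▸ (by simp [hxy])
      · have hgood : ∀ e ∈ ([(y, y), (x, x)] : List (α × BSub α 0)), Good t t e := by
          rw [List.forall_mem_cons, List.forall_mem_singleton]
          exact ⟨hg y, hg x⟩
        refine ⟨⟨by simp, fun e he => (hgood e he).mono h2, ?_, fun z => ?_⟩, hgood⟩
        · have : y < x := lt_of_le_of_ne (not_lt.1 ‹_›) (Ne.symm hxy)
          exact (hf y x).symm ▸ (by simpa using this)
        · exact (hf y x).symm ▸ (by simp [or_comm])
    exact ⟨(key s).1, fun _ => (key s).2⟩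
  | succ h ih =>
    obtain ⟨k1, k2, -, k4⟩ := wf_succ.1 hs
    obtain ⟨m1, m2⟩ := insertChildren_spec x (insert t x h)
      (fun e he hp => (ih (h1.trans h2) le_rfl he.2 hp).1) (s : BNode α (BSub α h)).children
      (by rw [← List.length_pos_iff]; lia) k4 hp
    have m3 := insertChildren_length_le x (insert t x h) (insert_length_le x)
      (s : BNode α (BSub α h)).children
    obtain ⟨n1, n2, n3, n4⟩ := regroup_spec (lo := lo) (by rw [← List.length_pos_iff]; lia)
      h2 (by lia) (by lia) m1.good m1.sorted
    exact ⟨⟨n1, n2, n3.symm ▸ m1.sorted, fun y => n3.symm ▸ m1.mem y⟩, n4⟩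

end BSub

/-! ### Deletion from a subtree -/

namespace BSub

/-- All subtrees satisfy the invariants, except that one of them may lack a child at the top. -/
def NearGood {α : Type} [LinearOrder α] (t : ℕ) {h : ℕ} : List (α × BSub α h) → Prop
  | [] => True
  | e :: l => (Good t t e ∧ NearGood t l) ∨ (Good t (t - 1) e ∧ ∀ e' ∈ l, Good t t e')

/-- `r` has at most one subtree, and exactly one if the subtrees are not leaves; it stores the
elements of `old` except `x`, in increasing order. -/
structure DeleteSpec {α : Type} [LinearOrder α] (t lo : ℕ) {h : ℕ} (x : α) (old : List α)
    (r : List (α × BSub α h)) : Prop where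
  length_le : r.length ≤ 1
  length_eq : h ≠ 0 → r.length = 1
  good : ∀ e ∈ r, Good t lo e
  sorted : (flat r).Pairwise (· < ·)
  mem : ∀ y, y ∈ flat r ↔ y ≠ x ∧ y ∈ old

variable {α : Type} {t lo h : ℕ}

theorem leaves_sublist_flat {l : List (α × BSub α h)} {e : α × BSub α h} (he : e ∈ l) :
    (leaves h e.2).Sublist (flat l) := by
  obtain ⟨l₁, l₂, rfl⟩ := List.append_of_mem he
  rw [flat_append, flat_cons]
  exact (List.sublist_append_left _ _).trans (List.sublist_append_right _ _)

/-- The children of the top node. -/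
def kids (e : α × BSub α (h + 1)) : List (α × BSub α h) :=
  (show BNode α (BSub α h) from e.2).children

/-- This and the next two are the defining equations of `rebalanceNodes`, restated so that entries
keep the type `α × BSub α (h + 1)` on which `Good` and `flat` are defined. -/
theorem rebalance_nil : rebalance t (h + 1) ([] : List (α × BSub α (h + 1))) =
    (do Timed.tick; pure []) := rfl

theorem rebalance_singleton (e : α × BSub α (h + 1)) : rebalance t (h + 1) [e] =
    (do Timed.tick; pure [e]) := rfl

theorem rebalance_cons_cons (e e' : α × BSub α (h + 1)) (l : List (α × BSub α (h + 1))) :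
    rebalance t (h + 1) (e :: e' :: l) = (do
      Timed.ticks (1 + (kids e).length + (kids e').length)
      if (kids e).length < t ∨ (kids e').length < t then do
        let r ← regroup t (kids e ++ kids e')
        Timed.ticks r.length
        pure (r ++ l)
      else do
        let r ← rebalance t (h + 1) (e' :: l)
        pure (e :: r)) := rfl

variable [LinearOrder α]

theorem nearGood_of_good {l : List (α × BSub α h)} (hl : ∀ e ∈ l, Good t t e) : NearGood t l := by
  induction l with
  | nil => trivial
  | cons e l ih =>
    rw [List.forall_mem_cons] at hl
    exact Or.inl ⟨hl.1, ih hl.2⟩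

theorem deleteChildren_time_le {β : Type} (x : α) (f : β → Timed (List (α × β)))
    (hf : ∀ b, (f b).val.length ≤ 1) {B : ℕ} (l : List (α × β))
    (hB : ∀ e ∈ l, (f e.2).time ≤ B) :
    (deleteChildren x f l).time ≤ l.length + 2 + B := by
  fun_induction deleteChildren x f l with
  | case1 => simp; lia
  | case2 e l ih =>
    have := hf e.2
    have := hB e (by simp)
    have := ih fun a ha => hB a (List.mem_cons_of_mem _ ha)
    simp only [Timed.bind_time]
    split_ifs with hx
    · simp; lia
    · simp; lia

/-- Only a leaf can vanish, so the list shrinks by at most one entry, and not at all if the children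
are internal. In that case the defect is a single child node that may lack one of its own children,
which is `NearGood`. -/
theorem deleteChildren_spec (x : α) (f : BSub α h → Timed (List (α × BSub α h)))
    (hf : ∀ e : α × BSub α h, Good t t e → (leaves h e.2).Pairwise (· < ·) →
      DeleteSpec t (t - 1) x (leaves h e.2) (f e.2).val)
    (l : List (α × BSub α h)) (hl : ∀ e ∈ l, Good t t e) (hs : (flat l).Pairwise (· < ·)) :
    NearGood t (deleteChildren x f l).val ∧ (flat (deleteChildren x f l).val).Pairwise (· < ·) ∧
      (∀ y, y ∈ flat (deleteChildren x f l).val ↔ y ≠ x ∧ y ∈ flat l) ∧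
      (deleteChildren x f l).val.length ≤ l.length ∧
      l.length ≤ (deleteChildren x f l).val.length + 1 ∧
      (h ≠ 0 → (deleteChildren x f l).val.length = l.length) := by
  fun_induction deleteChildren x f l with
  | case1 => simp [NearGood]
  | case2 e l ih =>
    rw [flat_cons, List.pairwise_append] at hs
    rw [List.forall_mem_cons] at hl
    simp only [Timed.bind_val]
    split_ifs with hx
    · simp only [Timed.bind_val, Timed.pure_val]
      have hd := hf e hl.1 hs.1
      have hlen := hd.length_le
      refine ⟨?_, ?_, ?_, ?_, ?_, ?_⟩
      · match hr : (f e.2).val with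
        | [] => exact nearGood_of_good hl.2
        | [a] => exact Or.inr ⟨hd.good a (by simp [hr]), hl.2⟩
        | a :: b :: r => simp [hr] at hlen
      · rw [flat_append, List.pairwise_append]
        exact ⟨hd.sorted, hs.2.1, fun a ha b hb => hs.2.2 _ ((hd.mem a).1 ha).2 _ hb⟩
      · intro y
        -- Everything to the right of the chosen child exceeds its maximum, so `x` has no occurrence
        -- there that would be missed.
        have : y ∈ flat l → y ≠ x := fun hy =>
          (hx.trans_lt (hs.2.2 _ hl.1.1.1 _ hy)).ne'
        simp only [flat_append, List.mem_append, hd.mem, flat_cons]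
        tauto
      · simp only [List.length_append, List.length_cons]; lia
      · simp only [List.length_append, List.length_cons]; lia
      · intro hh
        have := hd.length_eq hh
        simp only [List.length_append, List.length_cons]; lia
    · simp only [Timed.bind_val, Timed.pure_val]
      obtain ⟨h1, h2, h3, h4, h5, h6⟩ := ih hl.2 hs.2.1
      refine ⟨Or.inl ⟨hl.1, h1⟩, ?_, ?_, ?_, ?_, ?_⟩
      · rw [flat_cons, List.pairwise_append]
        exact ⟨hs.1, h2, fun a ha b hb => hs.2.2 _ ha _ ((h3 b).1 hb).2⟩
      · intro y
        have : y ∈ leaves h e.2 → y ≠ x := fun hy => ((hl.1.1.2 hy).trans_lt (not_le.1 hx)).ne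
        simp only [List.mem_append, h3, flat_cons]
        tauto
      · simpa using h4
      · simpa using h5
      · simpa using h6

theorem Good.le_length_kids {e : α × BSub α (h + 1)} (he : Good t lo e) :
    lo ≤ (kids e).length := he.2.1

theorem Good.length_kids_le {e : α × BSub α (h + 1)} (he : Good t lo e) :
    (kids e).length ≤ 2 * t := he.2.2.1

theorem Good.kids {e : α × BSub α (h + 1)} (he : Good t lo e) :
    ∀ a ∈ kids e, Good t t a := he.2.2.2.2

/-- A node with `t - 1` children and a neighbour with between `t` and `2 * t` together have enough
children for one legal node and few enough for two. A deficient node needs a neighbour, hence the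
hypothesis `h2`. -/
theorem rebalance_succ_spec (ht : 2 ≤ t) (l : List (α × BSub α (h + 1))) (hl : NearGood t l)
    (h2 : 2 ≤ l.length ∨ ∀ e ∈ l, Good t t e) (hs : (flat l).Pairwise (· < ·)) :
    (∀ e ∈ (rebalance t (h + 1) l).val, Good t t e) ∧
      flat (rebalance t (h + 1) l).val = flat l ∧
      (rebalance t (h + 1) l).val.length ≤ l.length ∧
      l.length ≤ (rebalance t (h + 1) l).val.length + 1 ∧
      (rebalance t (h + 1) l).time ≤ l.length * (16 * t + 10) + 1 := by
  induction l with
  | nil => simp [rebalance_nil]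
  | cons e l ih =>
    cases l with
    | nil =>
      have : ∀ a ∈ [e], Good t t a := h2.resolve_left (by simp)
      simpa [rebalance_singleton] using this
    | cons e' l =>
      have hs' := hs
      rw [flat_cons, List.pairwise_append] at hs'
      have hge : Good t (t - 1) e := by
        rcases hl with ⟨h1, -⟩ | ⟨h1, -⟩
        exacts [h1.mono (Nat.sub_le _ _), h1]
      have hge' : Good t (t - 1) e' := by
        rcases hl with ⟨-, ⟨h1, -⟩ | ⟨h1, -⟩⟩ | ⟨-, h1⟩
        exacts [h1.mono (Nat.sub_le _ _), h1, (h1 e' (by simp)).mono (Nat.sub_le _ _)]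
      have a1 := hge.le_length_kids
      have a2 := hge.length_kids_le
      have a4 := hge.kids
      have b1 := hge'.le_length_kids
      have b2 := hge'.length_kids_le
      have b4 := hge'.kids
      rw [rebalance_cons_cons]
      simp only [Timed.bind_val, Timed.bind_time]
      split_ifs with hc
      -- At most one node of the list is short. Since it is one of these two, the tail is sound and
      -- the merged node has at least `2 * t - 1 ≥ t` children.
      · have hgl : t - 1 + t ≤ (kids e).length +
            (kids e').length ∧ ∀ a ∈ l, Good t t a := by
          rcases hl with ⟨h1, ⟨h3, -⟩ | ⟨-, h3⟩⟩ | ⟨-, h1⟩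
          · have := h1.le_length_kids
            have := h3.le_length_kids
            lia
          · have := h1.le_length_kids
            exact ⟨by lia, h3⟩
          · rw [List.forall_mem_cons] at h1
            have := h1.1.le_length_kids
            exact ⟨by lia, h1.2⟩
        have hcat : flat (kids e ++
            kids e') = leaves (h + 1) e.2 ++ leaves (h + 1) e'.2 :=
          flat_append _ _
        have hsort : (flat (kids e ++
            kids e')).Pairwise (· < ·) := by
          rw [hcat]
          rw [flat_cons, flat_cons, ← List.append_assoc, List.pairwise_append] at hs
          exact hs.1
        obtain ⟨n1, n2, n3, -⟩ := regroup_spec (t := t) (lo := t)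
          (l := kids e ++ kids e')
          (by rw [← List.length_pos_iff, List.length_append]; lia) le_rfl
          (by rw [List.length_append]; lia) (by rw [List.length_append]; lia)
          (fun a ha => (List.mem_append.1 ha).elim (a4 a) (b4 a)) hsort
        have n4 := regroup_length_le (t := t)
          (kids e ++ kids e')
        have n5 := regroup_time (t := t)
          (kids e ++ kids e')
        rw [List.length_append] at n5
        simp only [Timed.bind_val, Timed.pure_val, Timed.bind_time, Timed.pure_time,
          Timed.ticks_time]
        refine ⟨fun a ha => (List.mem_append.1 ha).elim (n2 a) (hgl.2 a), ?_, ?_, ?_, ?_⟩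
        · rw [flat_append, n3, hcat, flat_cons, flat_cons, List.append_assoc]
        · simp only [List.length_append, List.length_cons]
          lia
        · simp only [List.length_append, List.length_cons]
          lia
        · simp only [List.length_cons]
          nlinarith
      · have hw : t ≤ (kids e).length ∧
            t ≤ (kids e').length := by lia
        have hgt : Good t t e := ⟨hge.1, hw.1, hge.2.2⟩
        have hgt' : Good t t e' := ⟨hge'.1, hw.2, hge'.2.2⟩
        have hnl : NearGood t (e' :: l) := by
          rcases hl with ⟨-, h1⟩ | ⟨-, h1⟩
          exacts [h1, nearGood_of_good h1]
        -- If `e'` is the last node it has no neighbour left, but the failed test has just shown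
        -- that it is not deficient.
        have hnl' : 2 ≤ (e' :: l).length ∨ ∀ a ∈ e' :: l, Good t t a := by
          cases l with
          | nil => exact Or.inr (by simpa using hgt')
          | cons a l => exact Or.inl (by simp)
        obtain ⟨m1, m2, m3, m4, m5⟩ := ih hnl hnl' hs'.2.1
        simp only [Timed.bind_val, Timed.pure_val, Timed.bind_time, Timed.pure_time,
          Timed.ticks_time]
        refine ⟨?_, ?_, Nat.succ_le_succ m3, Nat.succ_le_succ m4, ?_⟩
        · exact List.forall_mem_cons.2 ⟨hgt, m1⟩
        · exact congrArg (leaves (h + 1) e.2 ++ ·) m2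
        · rw [List.length_cons, Nat.succ_mul]
          lia

theorem delete_length_le (x : α) (s : BSub α h) : (delete t x h s).val.length ≤ 1 := by
  cases h with
  | zero =>
    have key : ∀ y : α, (delete t x 0 (y : BSub α 0)).val.length ≤ 1 := by
      intro y
      rw [delete]
      split_ifs <;> simp
    exact key s
  | succ h => exact pack_length_le _

theorem rebalance_spec (ht : 2 ≤ t) (l : List (α × BSub α h)) (hl : NearGood t l)
    (h2 : h ≠ 0 → 2 ≤ l.length) (hs : (flat l).Pairwise (· < ·)) :
    (∀ e ∈ (rebalance t h l).val, Good t t e) ∧ flat (rebalance t h l).val = flat l ∧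
      (rebalance t h l).val.length ≤ l.length ∧
      l.length ≤ (rebalance t h l).val.length + (if h = 0 then 0 else 1) ∧
      (rebalance t h l).time ≤ l.length * (16 * t + 10) + 1 := by
  cases h with
  | succ h => exact rebalance_succ_spec ht l hl (Or.inl (h2 (Nat.succ_ne_zero h))) hs
  | zero =>
    refine ⟨?_, rfl, le_rfl, le_rfl, Nat.zero_le _⟩
    change ∀ e ∈ l, Good t t e
    clear hs h2
    induction l with
    | nil => simp
    | cons e l ih =>
      rw [List.forall_mem_cons]
      rcases hl with h1 | h1
      exacts [⟨h1.1, ih h1.2⟩, ⟨⟨h1.1.1, trivial⟩, h1.2⟩]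

/-- Each level loses at most one child, so the top degree drops from `lo` to `lo - 1` at worst. As
`lo ≥ 2` the node never becomes empty. -/
theorem delete_spec (x : α) {s : BSub α h} (ht : 2 ≤ t) (h1 : 2 ≤ lo) (hs : WF t lo h s)
    (hp : (leaves h s).Pairwise (· < ·)) :
    DeleteSpec t (lo - 1) x (leaves h s) (delete t x h s).val ∧
      (delete t x h s).time ≤ (h + 1) * (32 * t ^ 2 + 24 * t + 10) := by
  induction h generalizing lo with
  | zero =>
    have key : ∀ y : α, DeleteSpec t (lo - 1) x [y] (delete t x 0 (y : BSub α 0)).val ∧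
        (delete t x 0 (y : BSub α 0)).time ≤ 1 := by
      intro y
      have hf' : ∀ a : α, flat (h := 0) [(a, a)] = [a] := fun a => rfl
      rw [delete]
      split_ifs with hxy
      · refine ⟨⟨by simp, by simp, by simp, by simp, fun z => ?_⟩, le_rfl⟩
        simp [hxy]
      · refine ⟨⟨by simp, by simp, ?_, ?_, fun z => ?_⟩, le_rfl⟩
        · intro e he
          obtain rfl := List.mem_singleton.1 he
          exact good_leaf y
        · exact (hf' y).symm ▸ (by simp)
        · refine (hf' y).symm ▸ ?_
          rw [List.mem_singleton]
          exact ⟨fun h => ⟨fun h' => hxy (h'.symm.trans h), h⟩, fun h => h.2⟩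
    exact ⟨(key s).1, (key s).2.trans (by lia)⟩
  | succ h ih =>
    obtain ⟨k1, k2, -, k4⟩ := wf_succ.1 hs
    obtain ⟨m1, m2, m3, m4, m5, m6⟩ := deleteChildren_spec x (delete t x h)
      (fun e he hp => (ih ht he.2 hp).1) (s : BNode α (BSub α h)).children k4 hp
    have m7 := deleteChildren_time_le x (delete t x h) (delete_length_le x)
      (s : BNode α (BSub α h)).children (B := (h + 1) * (32 * t ^ 2 + 24 * t + 10)) fun e he =>
        (ih ht (k4 e he).2 (List.Pairwise.sublist (leaves_sublist_flat he) hp)).2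
    obtain ⟨n1, n2, n3, n4, n5⟩ := rebalance_spec ht _ m1 (fun h0 => by have := m6 h0; lia) m2
    -- Just above the leaves only the deletion can remove a child; higher up only a merge can. The
    -- two losses never add up.
    have n6 : (s : BNode α (BSub α h)).children.length ≤ (rebalance t h
        (deleteChildren x (delete t x h) (s : BNode α (BSub α h)).children).val).val.length + 1 := by
      split_ifs at n4 with h0
      · lia
      · have := m6 h0
        lia
    obtain ⟨⟨e, he⟩, p1, p2⟩ := pack_spec (t := t) (lo := lo - 1)
      (l := (rebalance t h
        (deleteChildren x (delete t x h) (s : BNode α (BSub α h)).children).val).val)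
      (by rw [← List.length_pos_iff]; lia) (by lia) (by lia) n1 (n2.symm ▸ m2)
    have p3 := pack_time (rebalance t h
        (deleteChildren x (delete t x h) (s : BNode α (BSub α h)).children).val).val
    refine ⟨⟨delete_length_le x s, fun _ => ?_, p1, ?_, fun y => ?_⟩, ?_⟩
    · exact congrArg List.length he
    · exact p2.symm ▸ n2.symm ▸ m2
    · exact p2.symm ▸ n2.symm ▸ m3 y
    · simp only [delete, Timed.bind_time]
      -- The level costs at most `2 * t + 2` for the walk, `2 * t * (16 * t + 10) + 1` for
      -- rebalancing and `2 * t + 1` for packing.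
      rw [Nat.succ_mul (h + 1)]
      nlinarith

end BSub

/-! ### Random descent, and the height of a tree -/

namespace BSub

open scoped ENNReal

variable {α : Type} {t lo h : ℕ}

/-- The intervals used by `pick` partition the range of the draw, and a child is hit by as many
integers as its stored count. -/
theorem sum_Icc_pick (l : List (α × BSub α h)) (g : Option (BSub α h) → ℝ≥0∞) :
    ∑ i ∈ Finset.Icc 1 (l.map fun e => count h e.2).sum, g (pick i l).val =
      (l.map fun e => count h e.2 * g (some e.2)).sum := by
  -- Shifting to a sum from `0` allows the interval of the first child to be split off by
  -- `Finset.sum_range_add`.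
  have hr : ∀ (c : ℕ) (f : ℕ → ℝ≥0∞),
      ∑ i ∈ Finset.Icc 1 c, f i = ∑ i ∈ Finset.range c, f (i + 1) := by
    intro c f
    induction c with
    | zero => simp
    | succ c ih => rw [Finset.sum_Icc_succ_top (by lia), ih, Finset.sum_range_succ]
  rw [hr]
  induction l with
  | nil => simp
  | cons e l ih =>
    rw [List.map_cons, List.sum_cons, Finset.sum_range_add, List.map_cons, List.sum_cons, ← ih]
    congr 1
    · rw [Finset.sum_congr rfl (g := fun _ => g (some e.2))]
      · simp
      · intro i hi
        rw [Finset.mem_range] at hi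
        have : i + 1 ≤ count h e.2 := hi
        simp [pick, this]
    · refine Finset.sum_congr rfl fun i _ => ?_
      have h1 : ¬ count h e.2 + i + 1 ≤ count h e.2 := by lia
      have h2 : count h e.2 + i + 1 - count h e.2 = i + 1 := by lia
      simp [pick, h1, h2]

theorem pick_spec (l : List (α × BSub α h)) (i : ℕ) :
    (pick i l).time ≤ l.length + 1 ∧
      (1 ≤ i → i ≤ (l.map fun e => count h e.2).sum → ∃ e ∈ l, (pick i l).val = some e.2) := by
  induction l generalizing i with
  | nil => simp [pick]; lia
  | cons e l ih =>
    unfold pick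
    simp only [Timed.bind_val, Timed.bind_time]
    split_ifs with hi
    · simp
    · obtain ⟨h1, h2⟩ := ih (i - count h e.2)
      refine ⟨by simp; lia, fun _ h4 => ?_⟩
      rw [List.map_cons, List.sum_cons] at h4
      obtain ⟨a, ha, hp⟩ := h2 (by lia) (by lia)
      exact ⟨a, List.mem_cons_of_mem _ ha, hp⟩

variable [LinearOrder α]

/-- This bounds the height by the binary logarithm of the number of elements; base `2` covers the
root as well as the inner nodes. -/
theorem two_pow_le_length {s : BSub α h} (ht : 2 ≤ t) (h2 : 2 ≤ lo) (hs : WF t lo h s) :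
    2 ^ h ≤ (leaves h s).length := by
  induction h generalizing lo with
  | zero => exact le_rfl
  | succ h ih =>
    obtain ⟨h1, -, -, h4⟩ := wf_succ.1 hs
    have key : ∀ l : List (α × BSub α h), (∀ e ∈ l, Good t t e) →
        l.length * 2 ^ h ≤ (flat l).length := by
      intro l hl
      induction l with
      | nil => simp
      | cons e l ih' =>
        rw [List.forall_mem_cons] at hl
        have := ih' hl.2
        have := ih ht hl.1.2
        rw [List.length_cons, Nat.succ_mul, flat_cons, List.length_append]
        lia
    refine le_trans ?_ (key _ h4)
    rw [pow_succ, mul_comm]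
    exact Nat.mul_le_mul_right _ (h2.trans h1)

theorem length_leaves_pos {e : α × BSub α h} (he : Good t lo e) : 0 < (leaves h e.2).length :=
  List.length_pos_of_mem he.1.1

/-- A child is weighted by its count, and by induction the descent averages over its leaves; the
count cancels the denominator of that average. -/
theorem expect_rand {s : BSub α h} (hs : WF t lo h s) (hn : (leaves h s) ≠ [])
    (f : Option α → ℝ≥0∞) : (rand h s).expect f =
      ((leaves h s).map fun x => f (some x)).sum / (leaves h s).length := by
  induction h generalizing lo with
  | zero =>
    have key : ∀ y : α, (rand 0 (y : BSub α 0)).expect f =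
        ([y].map fun x => f (some x)).sum / [y].length := by
      intro y
      simp [rand]
    exact key s
  | succ h ih =>
    obtain ⟨-, -, -, h4⟩ := wf_succ.1 hs
    have key : ∀ l : List (α × BSub α h), (∀ e ∈ l, Good t t e) →
        (l.map fun e => (count h e.2 : ℝ≥0∞) * (rand h e.2).expect f).sum =
          ((flat l).map fun x => f (some x)).sum := by
      intro l hl
      induction l with
      | nil => simp
      | cons e l ih' =>
        rw [List.forall_mem_cons] at hl
        have hpos := length_leaves_pos hl.1
        rw [List.map_cons, List.sum_cons, ih' hl.2, flat_cons, List.map_append, List.sum_append,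
          ih hl.1.2 (List.ne_nil_of_length_pos hpos), hl.1.2.count_eq,
          ENNReal.mul_div_cancel (by exact_mod_cast hpos.ne') (by simp)]
    have hlen := sum_count h4
    have hpos : 0 < ((s : BNode α (BSub α h)).children.map fun e => count h e.2).sum := by
      rw [hlen]
      exact List.length_pos_iff.2 hn
    simp only [rand, RTimed.expect_bind, RTimed.expect_lift]
    rw [RTimed.expect_uniformIcc hpos]
    refine (congrArg (· / (_ : ℝ≥0∞)) (sum_Icc_pick (s : BNode α (BSub α h)).children
      (fun c => RTimed.expect (match c with
        | none => pure none
        | some s => rand h s) f))).trans ?_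
    rw [hlen]
    exact congrArg (· / (_ : ℝ≥0∞)) (key _ h4)

theorem rand_outcomes {s : BSub α h} (hs : WF t lo h s) (hn : (leaves h s) ≠ [])
    {o : Timed (Option α)} (ho : o ∈ (rand h s).outcomes) :
    o.time ≤ (h + 1) * (4 * t + 3) ∧ o.val ≠ none := by
  induction h generalizing lo o with
  | zero =>
    have key : ∀ y : α, o ∈ (rand 0 (y : BSub α 0)).outcomes → o = ⟨some y, 1⟩ := by
      intro y
      simp [rand]
    rw [key s ho]
    simp
  | succ h ih =>
    obtain ⟨-, h2, -, h4⟩ := wf_succ.1 hs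
    have hpos : 0 < ((s : BNode α (BSub α h)).children.map fun e => count h e.2).sum := by
      rw [sum_count h4]
      exact List.length_pos_iff.2 hn
    simp only [rand, RTimed.mem_outcomes_lift_bind] at ho
    obtain ⟨a, ha, rfl⟩ := ho
    obtain ⟨i, hi, b, hb, rfl⟩ := RTimed.mem_outcomes_bind.1 ha
    obtain ⟨j1, j2, j3⟩ := RTimed.mem_outcomes_uniformIcc hpos hi
    obtain ⟨p1, p2⟩ := pick_spec (s : BNode α (BSub α h)).children i.val
    obtain ⟨e, he, hp⟩ := p2 j2 j3
    simp only [RTimed.mem_outcomes_lift_bind, hp] at hb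
    obtain ⟨c, hc, rfl⟩ := hb
    obtain ⟨q1, q2⟩ := ih (h4 e he).2
      (List.ne_nil_of_length_pos (length_leaves_pos (h4 e he))) hc
    refine ⟨?_, q2⟩
    simp only [Timed.ticks_time, j1]
    rw [Nat.succ_mul (h + 1)]
    lia

end BSub

/-! ### Operations on whole trees, with logarithmic step bounds -/

namespace BTree

variable {α : Type} [LinearOrder α] {t : ℕ}

/-- A bound on the number of steps of an operation on a tree with `m` elements. -/
def stepBound (t m : ℕ) : ℕ := (Nat.log 2 m + 1) * (32 * t ^ 2 + 24 * t + 20)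

theorem stepBound_mono {m m' : ℕ} (h : m ≤ m') : stepBound t m ≤ stepBound t m' :=
  Nat.mul_le_mul_right _ (Nat.succ_le_succ (Nat.log_mono_right h))

theorem one_le_stepBound (m : ℕ) : 1 ≤ stepBound t m :=
  Nat.mul_pos (Nat.succ_pos _) (by lia)

theorem card_elems_tree {h : ℕ} {r : BSub α h} (hT : IsBTree t (tree h r)) :
    (elems (tree h r)).card = (BSub.leaves h r).length :=
  List.toFinset_card_of_nodup (hT.2.imp fun h => h.ne)

theorem mem_elems_tree {h : ℕ} {r : BSub α h} {x : α} :
    x ∈ elems (tree h r) ↔ x ∈ BSub.leaves h r := List.mem_toFinset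

theorem time_le_stepBound (ht : 2 ≤ t) {h : ℕ} {r : BSub α h} (hT : IsBTree t (tree h r))
    {c : ℕ} (hc : c ≤ (h + 1) * (32 * t ^ 2 + 24 * t + 20)) :
    c ≤ stepBound t (elems (tree h r)).card := by
  refine hc.trans (Nat.mul_le_mul_right _ (Nat.succ_le_succ ?_))
  rw [card_elems_tree hT]
  exact Nat.le_log_of_pow_le (by lia) (BSub.two_pow_le_length ht le_rfl hT.1)

theorem leaves_ne_nil (ht : 2 ≤ t) {h : ℕ} {r : BSub α h} (hT : IsBTree t (tree h r)) :
    BSub.leaves h r ≠ [] := by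
  rw [← List.length_pos_iff]
  exact (Nat.pow_pos (by lia)).trans_le (BSub.two_pow_le_length ht le_rfl hT.1)

theorem query_spec (ht : 2 ≤ t) {T : BTree α} (hT : T.IsBTree t) (x : α) :
    ((T.query x).val = true ↔ x ∈ T.elems) ∧ (T.query x).time ≤ stepBound t T.elems.card := by
  cases T with
  | empty => exact ⟨by simp [query, elems], one_le_stepBound _⟩
  | tree h r =>
    refine ⟨(BSub.query_val x hT.1 hT.2).trans mem_elems_tree.symm, time_le_stepBound ht hT ?_⟩
    exact (BSub.query_time x hT.1).trans (Nat.mul_le_mul_left _ (by lia))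

theorem insert_spec (ht : 2 ≤ t) {T : BTree α} (hT : T.IsBTree t) (x : α) :
    (T.insert t x).val.IsBTree t ∧ (T.insert t x).val.elems = Insert.insert x T.elems ∧
      (T.insert t x).time ≤ stepBound t T.elems.card := by
  cases T with
  | empty => exact ⟨⟨trivial, List.pairwise_singleton _ _⟩, rfl, one_le_stepBound _⟩
  | tree h r =>
    obtain ⟨h1, h2⟩ := BSub.insert_spec x (by lia) ht hT.1 hT.2
    have h3 := BSub.insert_length_le (t := t) x r
    have h4 := BSub.insert_time_le x hT.1
    simp only [insert, Timed.bind_val, Timed.bind_time]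
    match hl : (BSub.insert t x h r).val with
    | [] => exact absurd h1.pos (by simp [hl])
    | [e] =>
      rw [hl] at h1
      have hflat : BSub.flat [e] = BSub.leaves h e.2 := List.append_nil _
      refine ⟨⟨(h1.good e (by simp)).2, hflat ▸ h1.sorted⟩, ?_, time_le_stepBound ht hT ?_⟩
      · ext y
        rw [Finset.mem_insert, mem_elems_tree, ← h1.mem, hflat]
        exact mem_elems_tree
      · have : (ofList [e]).time = 1 := rfl
        rw [this]
        nlinarith
    | [e, e'] =>
      rw [hl] at h1 h2
      have hg := h2 (by simp)
      obtain ⟨⟨a, ha⟩, p1, p2⟩ := BSub.pack_spec (lo := 2) (List.cons_ne_nil e [e']) (by simp)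
        (by simp; lia) hg h1.sorted
      have hv : (ofList [e, e']).val = tree (h + 1) a.2 := by
        simp [ofList, ha]
      have hflat : BSub.leaves (h + 1) a.2 = BSub.flat [e, e'] := by
        rw [← p2, ha]
        exact (List.append_nil _).symm
      rw [ha] at p1
      rw [hv]
      refine ⟨⟨(p1 a (by simp)).2, hflat ▸ h1.sorted⟩, ?_, time_le_stepBound ht hT ?_⟩
      · ext y
        refine mem_elems_tree.trans ?_
        rw [Finset.mem_insert, mem_elems_tree, hflat]
        exact h1.mem y
      · have : (ofList [e, e']).time = 3 := rfl
        rw [this]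
        nlinarith
    | a :: b :: c :: l => simp [hl] at h3

/-- After a deletion the root may have a single child. That child is a leaf or has at least `t ≥ 2`
children, so it can serve as the root. -/
theorem collapse_spec {h : ℕ} {r : BSub α h} (ht : 2 ≤ t) (hw : BSub.WF t 1 h r)
    (hp : (BSub.leaves h r).Pairwise (· < ·)) : (collapse h r).val.IsBTree t ∧
      (∀ x, x ∈ (collapse h r).val.elems ↔ x ∈ BSub.leaves h r) ∧ (collapse h r).time = 1 := by
  cases h with
  | zero => exact ⟨⟨trivial, hp⟩, fun x => mem_elems_tree, rfl⟩
  | succ h =>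
    have key : ∀ v : BNode α (BSub α h), BSub.WF t 1 (h + 1) v →
        (BSub.flat v.children).Pairwise (· < ·) → (collapse (h + 1) v).val.IsBTree t ∧
        (∀ x, x ∈ (collapse (h + 1) v).val.elems ↔ x ∈ BSub.flat v.children) ∧
        (collapse (h + 1) v).time = 1 := by
      rintro ⟨c, l⟩ hw hp
      obtain ⟨h1, h2, h3, h4⟩ := BSub.wf_succ.1 hw
      match l with
      | [] => simp at h1
      | [e] =>
        have hflat : BSub.flat [e] = BSub.leaves h e.2 := List.append_nil _
        refine ⟨⟨(h4 e (by simp)).2.mono ht, hflat ▸ hp⟩, fun x => ?_, rfl⟩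
        rw [hflat]
        exact mem_elems_tree
      | a :: b :: l =>
        exact ⟨⟨⟨by simp, h2, h3, h4⟩, hp⟩, fun x => mem_elems_tree, rfl⟩
    exact key r hw hp

theorem delete_spec (ht : 2 ≤ t) {T : BTree α} (hT : T.IsBTree t) (x : α) :
    (T.delete t x).val.IsBTree t ∧ (T.delete t x).val.elems = T.elems.erase x ∧
      (T.delete t x).time ≤ stepBound t T.elems.card := by
  cases T with
  | empty => exact ⟨trivial, rfl, one_le_stepBound _⟩
  | tree h r =>
    obtain ⟨h1, h2⟩ := BSub.delete_spec x ht le_rfl hT.1 hT.2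
    simp only [delete, Timed.bind_val, Timed.bind_time]
    match hl : (BSub.delete t x h r).val with
    | [] =>
      rw [hl] at h1
      refine ⟨trivial, ?_, time_le_stepBound ht hT ?_⟩
      · ext y
        rw [Finset.mem_erase, mem_elems_tree, ← h1.mem]
        simp [elems]
      · simp only [Timed.pure_time]
        nlinarith
    | [e] =>
      rw [hl] at h1
      have hflat : BSub.flat [e] = BSub.leaves h e.2 := List.append_nil _
      obtain ⟨c1, c2, c3⟩ := collapse_spec ht (h1.good e (by simp)).2 (hflat ▸ h1.sorted)
      refine ⟨c1, ?_, time_le_stepBound ht hT ?_⟩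
      · ext y
        rw [Finset.mem_erase, mem_elems_tree, ← h1.mem, hflat]
        exact c2 y
      · simp only [c3]
        nlinarith
    | a :: b :: l => exact absurd h1.length_le (by simp [hl])

open scoped ENNReal

theorem expect_rand (ht : 2 ≤ t) {T : BTree α} (hT : T.IsBTree t) (hne : T.elems.Nonempty)
    (f : Option α → ℝ≥0∞) :
    T.rand.expect f = (∑ x ∈ T.elems, f (some x)) / T.elems.card := by
  cases T with
  | empty => simp [elems] at hne
  | tree h r =>
    rw [card_elems_tree hT]
    refine (BSub.expect_rand hT.1 (leaves_ne_nil ht hT) f).trans (congrArg (· / _) ?_)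
    exact (List.sum_toFinset _ (hT.2.imp fun h => h.ne)).symm

theorem law_rand (ht : 2 ≤ t) {T : BTree α} (hT : T.IsBTree t) {x : α} (hx : x ∈ T.elems) :
    T.rand.law (some x) = ((T.elems.card : ℝ≥0∞))⁻¹ := by
  classical
  rw [RTimed.law_apply_eq_expect, expect_rand ht hT ⟨x, hx⟩, ENNReal.div_eq_inv_mul]
  simp [hx]

theorem rand_outcomes (ht : 2 ≤ t) {T : BTree α} (hT : T.IsBTree t) {o : Timed (Option α)}
    (ho : o ∈ T.rand.outcomes) :
    o.time ≤ stepBound t T.elems.card ∧ (T.elems.Nonempty → o.val ≠ none) ∧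
      (T.elems = ∅ → o.val = none) := by
  cases T with
  | empty =>
    simp only [rand, RTimed.mem_outcomes_lift_bind, RTimed.mem_outcomes_pure] at ho
    obtain ⟨-, rfl, rfl⟩ := ho
    exact ⟨one_le_stepBound _, fun h => absurd h (by simp [elems]), fun _ => rfl⟩
  | tree h r =>
    have hn := leaves_ne_nil ht hT
    obtain ⟨h1, h2⟩ := BSub.rand_outcomes hT.1 hn ho
    refine ⟨time_le_stepBound ht hT (h1.trans (Nat.mul_le_mul_left _ (by lia))), fun _ => h2, ?_⟩
    intro h3
    rw [elems, List.toFinset_eq_empty_iff] at h3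
    exact absurd h3 hn

theorem size_spec {T : BTree α} (hT : T.IsBTree t) :
    T.size.val = T.elems.card ∧ T.size.time = 1 := by
  cases T with
  | empty => exact ⟨rfl, rfl⟩
  | tree h r => exact ⟨hT.1.count_eq.trans (card_elems_tree hT).symm, rfl⟩

theorem stepBound_le_log (m : ℕ) :
    (stepBound t m : ℝ) ≤ 4 * (32 * t ^ 2 + 24 * t + 20) * Real.log (m + 2) := by
  have h1 : (Nat.log 2 m : ℝ) * Real.log 2 ≤ Real.log (m + 2) := by
    rw [← Real.log_pow]
    refine Real.log_le_log (by positivity) ?_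
    rcases Nat.eq_zero_or_pos m with rfl | hm
    · simp
    · have : (2 : ℝ) ^ Nat.log 2 m ≤ m := by exact_mod_cast Nat.pow_log_le_self 2 hm.ne'
      linarith
  have h2 : Real.log 2 ≤ Real.log (m + 2) := Real.log_le_log (by norm_num) (by simp)
  have h3 := Real.log_two_gt_d9
  -- By `h1` and `h2` the left side times `log 2` is at most `2 * log (m + 2)`, and `log 2 > 1 / 2`.
  have h4 : (Nat.log 2 m : ℝ) + 1 ≤ 4 * Real.log (m + 2) := by
    have : (0 : ℝ) ≤ Nat.log 2 m := Nat.cast_nonneg _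
    nlinarith
  rw [stepBound]
  push_cast
  nlinarith [show (0 : ℝ) ≤ 32 * t ^ 2 + 24 * t + 20 by positivity]

end BTree

/-! ### The greedy rounds for fixed samples -/

namespace MaxCover

theorem countWhite_val {α : Type} (R : List (α × Bool)) :
    (countWhite R).val = R.countP fun a => !a.2 := by
  induction R with
  | nil => rfl
  | cons a R ih =>
    simp only [countWhite, Timed.bind_val, Timed.pure_val, ih, List.countP_cons]
    cases a.2 <;> simp

theorem countWhite_time {α : Type} (R : List (α × Bool)) : (countWhite R).time = R.length + 1 := by
  induction R with
  | nil => rfl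
  | cons a R ih =>
    simp only [countWhite, Timed.bind_time, Timed.pure_time, Timed.tick_time, ih, List.length_cons]
    lia

variable {α : Type} [LinearOrder α] {n : ℕ}

/-- The union of the sets with index in `H`. -/
def union (A : Fin n → BTree α) (H : Finset (Fin n)) : Finset α :=
  H.biUnion fun i => (A i).elems

/-- The item with index `i`, when the samples `S i` have been updated with the set `U`. -/
def item (A : Fin n → BTree α) (S : Fin n → List α) (U : Finset α) (i : Fin n) : Item n α :=
  ⟨i, A i, (A i).elems.card, (S i).map fun x => (x, decide (x ∈ U))⟩

/-- The estimate of the number of elements of the set with index `i` that are not in `U`. -/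
def estimate (A : Fin n → BTree α) (S : Fin n → List α) (w : ℕ) (U : Finset α) (i : Fin n) : ℚ :=
  ((S i).countP fun x => decide (x ∉ U) : ℕ) / (w : ℚ) * ((A i).elems.card : ℚ)

theorem estimate_nonneg (A : Fin n → BTree α) (S : Fin n → List α) (w : ℕ) (U : Finset α)
    (i : Fin n) : 0 ≤ estimate A S w U i := by
  unfold estimate
  positivity

theorem markSamples_val {B : BTree α} (hB : ∀ x, (B.query x).val = true ↔ x ∈ B.elems)
    (R : List (α × Bool)) :
    (markSamples B R).val = R.map fun a => (a.1, a.2 || decide (a.1 ∈ B.elems)) := by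
  induction R with
  | nil => rfl
  | cons a R ih =>
    have : (B.query a.1).val = decide (a.1 ∈ B.elems) := by
      rw [Bool.eq_iff_iff, hB, decide_eq_true_iff]
    simp [markSamples, ih, this]

theorem markSamples_time {B : BTree α} {q : ℕ} (hB : ∀ x, (B.query x).time ≤ q)
    (R : List (α × Bool)) : (markSamples B R).time ≤ R.length * (q + 1) + 1 := by
  induction R with
  | nil => simp [markSamples]
  | cons a R ih =>
    have := hB a.1
    simp only [markSamples, Timed.bind_time, Timed.tick_time, Timed.pure_time, List.length_cons]
    lia

variable {A : Fin n → BTree α} {S : Fin n → List α} {w q : ℕ}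

/-- Black marks accumulate, so testing against the newest set alone suffices. The marks lag one pick
behind at the start of a round, which explains `H.tail`. -/
theorem updateSamples_val (hA : ∀ i x, ((A i).query x).val = true ↔ x ∈ (A i).elems)
    (H : List (Fin n)) (R : List α) :
    (updateSamples (H.map A) (R.map fun x => (x, decide (x ∈ union A H.tail.toFinset)))).val =
      R.map fun x => (x, decide (x ∈ union A H.toFinset)) := by
  cases H with
  | nil => rfl
  | cons i H =>
    simp only [updateSamples, List.map_cons, Timed.bind_val, markSamples_val (hA i), List.map_map,
      List.tail_cons]
    refine List.map_congr_left fun x _ => ?_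
    simp [union, Bool.or_comm]

theorem updateSamples_time (hq : ∀ i x, ((A i).query x).time ≤ q) (H : List (Fin n))
    (R : List (α × Bool)) :
    (updateSamples (H.map A) R).time ≤ R.length * (q + 1) + 2 := by
  cases H with
  | nil => simp [updateSamples]
  | cons i H =>
    have := markSamples_time (hq i) R
    simp only [updateSamples, List.map_cons, Timed.bind_time, Timed.tick_time]
    lia

/-- The running best must be arbitrary for the induction, so the result either is the initial best
or comes from a scanned set. -/
theorem scan_spec (hA : ∀ i x, ((A i).query x).val = true ↔ x ∈ (A i).elems)
    (H : List (Fin n)) (l : List (Fin n)) (best : ℚ × Option (Item n α)) :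
    ((scan w (H.map A) (l.map (item A S (union A H.tail.toFinset))) best).val.1 =
      l.map (item A S (union A H.toFinset))) ∧
    (best.1 ≤ (scan w (H.map A) (l.map (item A S (union A H.tail.toFinset))) best).val.2.1) ∧
    (∀ i ∈ l, estimate A S w (union A H.toFinset) i ≤
      (scan w (H.map A) (l.map (item A S (union A H.tail.toFinset))) best).val.2.1) ∧
    ((scan w (H.map A) (l.map (item A S (union A H.tail.toFinset))) best).val.2 = best ∨
      ∃ i ∈ l, (scan w (H.map A) (l.map (item A S (union A H.tail.toFinset))) best).val.2 =
        (estimate A S w (union A H.toFinset) i, some (item A S (union A H.toFinset) i))) := by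
  induction l generalizing best with
  | nil => simp [scan]
  | cons i l ih =>
    have hu := updateSamples_val hA H (S i)
    have hc : (countWhite ((S i).map fun x => (x, decide (x ∈ union A H.toFinset)))).val =
        (S i).countP fun x => decide (x ∉ union A H.toFinset) := by
      rw [countWhite_val, List.countP_map]
      refine List.countP_congr fun x _ => ?_
      simp
    have hs : ((countWhite ((S i).map fun x => (x, decide (x ∈ union A H.toFinset)))).val : ℚ) / w *
        ((A i).elems.card : ℚ) = estimate A S w (union A H.toFinset) i := by
      rw [hc, estimate]
    simp only [List.map_cons, scan, Timed.bind_val, Timed.pure_val]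
    simp only [item] at hu ⊢
    simp only [hu, hs]
    obtain ⟨h1, h2, h3, h4⟩ := ih (if best.1 < estimate A S w (union A H.toFinset) i then
      (estimate A S w (union A H.toFinset) i, some (item A S (union A H.toFinset) i)) else best)
    simp only [item] at h1 h2 h3 h4
    refine ⟨by rw [h1], ?_, ?_, ?_⟩
    · refine le_trans ?_ h2
      split_ifs with hlt
      exacts [hlt.le, le_rfl]
    · rw [List.forall_mem_cons]
      refine ⟨le_trans ?_ h2, h3⟩
      split_ifs with hlt
      exacts [le_rfl, not_lt.1 hlt]
    · rcases h4 with h4 | ⟨a, ha, h4⟩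
      · rw [h4]
        split_ifs
        · exact Or.inr ⟨i, by simp, rfl⟩
        · exact Or.inl rfl
      · exact Or.inr ⟨a, List.mem_cons_of_mem _ ha, h4⟩

theorem scan_time (hq : ∀ i x, ((A i).query x).time ≤ q) (hS : ∀ i, (S i).length ≤ w)
    (U : Finset α) (H : List (Fin n)) (l : List (Fin n)) (best : ℚ × Option (Item n α))
    (hA : ∀ i x, ((A i).query x).val = true ↔ x ∈ (A i).elems) (hU : U = union A H.tail.toFinset) :
    (scan w (H.map A) (l.map (item A S U)) best).time ≤ l.length * (w * (q + 2) + 4) + 1 := by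
  induction l generalizing best with
  | nil => simp [scan]
  | cons i l ih =>
    have hu := updateSamples_val hA H (S i)
    rw [← hU] at hu
    have ht := updateSamples_time hq H (item A S U i).samples
    have hl : (item A S U i).samples.length ≤ w := by simpa [item] using hS i
    have hc : (countWhite (updateSamples (H.map A) (item A S U i).samples).val).time ≤ w + 1 := by
      rw [countWhite_time]
      simp only [item, hu, List.length_map]
      simpa using hS i
    simp only [List.map_cons, scan, Timed.bind_time, Timed.tick_time, Timed.pure_time,
      List.length_cons]
    refine (Nat.add_le_add_left (Nat.add_le_add ht (Nat.add_le_add hc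
      (Nat.add_le_add_right (ih _) 0))) 1).trans ?_
    have : (item A S U i).samples.length * (q + 1) ≤ w * (q + 1) := Nat.mul_le_mul_right _ hl
    nlinarith

theorem removeItem_spec (U : Finset α) (i : Fin n) (l : List (Fin n)) :
    (removeItem i (l.map (item A S U))).val = (l.erase i).map (item A S U) ∧
      (removeItem i (l.map (item A S U))).time ≤ l.length + 1 := by
  induction l with
  | nil => simp [removeItem]
  | cons a l ih =>
    have hidx : (item A S U a).idx = a := rfl
    simp only [List.map_cons, removeItem, hidx, Timed.bind_val, Timed.bind_time]
    split_ifs with h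
    · subst h
      simp
    · simp [h, ih]
      lia

/-- A property of the list of picked indices and the current estimate that is preserved when an
index with the largest estimate is picked holds for the result of the algorithm. -/
theorem greedy_spec (hA : ∀ i x, ((A i).query x).val = true ↔ x ∈ (A i).elems)
    (hq : ∀ i x, ((A i).query x).time ≤ q) (hS : ∀ i, (S i).length ≤ w) {k : ℕ} (hk : k ≤ n)
    (P : List (Fin n) → ℚ → Prop)
    (hP : ∀ H z i, P H z → H.Nodup → i ∉ H → H.length < k →
      (∀ a, a ∉ H → estimate A S w (union A H.toFinset) a ≤
        estimate A S w (union A H.toFinset) i) →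
      P (i :: H) (z + estimate A S w (union A H.toFinset) i))
    (j : ℕ) (l H : List (Fin n)) (z : ℚ) (hl : l.Nodup) (hlH : ∀ i, i ∈ l ↔ i ∉ H)
    (hH : H.Nodup) (hj : H.length + j = k) (h0 : P H z) :
    (greedy w j (l.map (item A S (union A H.tail.toFinset))) (H.map A) z H).time ≤
      j * (n * (w * (q + 2) + 5) + 3) + 1 ∧
    (greedy w j (l.map (item A S (union A H.tail.toFinset))) (H.map A) z H).val.2.Nodup ∧
    (greedy w j (l.map (item A S (union A H.tail.toFinset))) (H.map A) z H).val.2.length = k ∧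
    P (greedy w j (l.map (item A S (union A H.tail.toFinset))) (H.map A) z H).val.2
      (greedy w j (l.map (item A S (union A H.tail.toFinset))) (H.map A) z H).val.1 := by
  induction j generalizing l H z with
  | zero => exact ⟨le_rfl.trans (by simp [greedy]), hH, hj, h0⟩
  | succ j ih =>
    obtain ⟨s1, s2, s3, s4⟩ := scan_spec (w := w) (S := S) hA H l (-1, none)
    have s5 := scan_time hq hS _ H l (-1, none) hA rfl
    obtain ⟨a, ha⟩ : ∃ a, a ∉ H := by
      by_contra! hall
      have := (List.toFinset_card_le H).trans_lt (show H.length < n by lia)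
      rw [show H.toFinset = Finset.univ from Finset.eq_univ_iff_forall.2 fun i => by simp [hall i]]
        at this
      simp at this
    -- Estimates are nonnegative and the scan starts from `-1`, so a set is picked even when all
    -- estimates vanish. This gives exactly `k` indices.
    have hne : (scan w (H.map A) (l.map (item A S (union A H.tail.toFinset))) (-1, none)).val.2 ≠
        (-1, none) := by
      intro h
      have h1 := s3 a ((hlH a).2 ha)
      rw [h] at h1
      have := estimate_nonneg A S w (union A H.toFinset) a
      linarith
    obtain ⟨i, hi, h4⟩ := s4.resolve_left hne
    have hiH := (hlH i).1 hi
    obtain ⟨r1, r2⟩ := removeItem_spec (A := A) (S := S) (union A H.toFinset) i l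
    have hlen : l.length ≤ n := by
      simpa using hl.length_le_card
    have hidx : (item A S (union A H.toFinset) i).idx = i := rfl
    have htree : (item A S (union A H.toFinset) i).tree = A i := rfl
    simp only [greedy, Timed.bind_val, Timed.bind_time, Timed.tick_time, h4, s1, hidx, htree, r1]
    obtain ⟨g1, g2⟩ := ih (l.erase i) (i :: H)
      (z + estimate A S w (union A H.toFinset) i) (hl.erase i)
      (fun b => by rw [hl.mem_erase_iff, hlH, List.mem_cons, not_or])
      (List.nodup_cons.2 ⟨hiH, hH⟩) (by rw [List.length_cons]; lia)
      (hP H z i h0 hH hiH (by lia) fun b hb => by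
        have := s3 b ((hlH b).2 hb)
        rwa [h4] at this)
    refine ⟨?_, g2⟩
    rw [List.tail_cons, List.map_cons] at g1
    have : l.length * (w * (q + 2) + 4) ≤ n * (w * (q + 2) + 4) := Nat.mul_le_mul_right _ hlen
    nlinarith

end MaxCover

/-! ### Random samples and concentration -/

namespace MaxCover

open scoped ENNReal
open RTimed

/-- The union bound needs only sums over the sets, hence linearity; independence between different
sets plays no role. -/
theorem expect_initItems {α : Type} {n : ℕ} (A : Fin n → BTree α) (w : ℕ) (l : List (Fin n))
    (f : Fin n → List (α × Bool) → ℝ≥0∞) :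
    (initItems A w l).expect (fun L => (L.map fun a => f a.idx a.samples).sum) =
      (l.map fun i => (randomSamples (A i) w).expect (f i)).sum := by
  induction l with
  | nil => simp [initItems]
  | cons i l ih =>
    simp [initItems, expect_add, ih]

variable {α : Type} [LinearOrder α] {n t w : ℕ}

theorem randomSamples_outcomes (ht : 2 ≤ t) {T : BTree α} (hT : T.IsBTree t) {q : ℕ}
    (hq : BTree.stepBound t T.elems.card ≤ q) {o : Timed (List (α × Bool))}
    (ho : o ∈ (randomSamples T w).outcomes) :
    o.time ≤ w * (q + 1) + 1 ∧ ∃ R : List α, o.val = R.map (fun x => (x, false)) ∧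
      R.length ≤ w ∧ (T.elems.Nonempty → R.length = w) := by
  induction w generalizing o with
  | zero =>
    simp only [randomSamples, mem_outcomes_lift_bind, mem_outcomes_pure] at ho
    obtain ⟨-, rfl, rfl⟩ := ho
    exact ⟨by simp, [], rfl, le_rfl, fun _ => rfl⟩
  | succ w ih =>
    simp only [randomSamples, mem_outcomes_lift_bind] at ho
    obtain ⟨o1, ho1, rfl⟩ := ho
    obtain ⟨x, hx, b, hb, rfl⟩ := mem_outcomes_bind.1 ho1
    obtain ⟨R, hR, c, hc, rfl⟩ := mem_outcomes_bind.1 hb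
    obtain ⟨h1, R', h2, h3, h4⟩ := ih hR
    obtain ⟨x1, x2, x3⟩ := BTree.rand_outcomes ht hT hx
    rw [Nat.succ_mul]
    cases hv : x.val with
    | none =>
      rw [hv] at hc
      simp only [mem_outcomes_pure] at hc
      subst hc
      refine ⟨?_, R', h2, by lia, fun h => absurd hv (x2 h)⟩
      simp only [Timed.tick_time]
      lia
    | some a =>
      rw [hv] at hc
      simp only [mem_outcomes_pure] at hc
      subst hc
      refine ⟨?_, a :: R', by simp [h2], by simpa using h3, fun h => by simpa using h4 h⟩
      simp only [Timed.tick_time]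
      lia

/-- Each outcome is encoded by a family `S` of sample lists, to which the deterministic analysis of
the rounds applies. -/
theorem initItems_outcomes (ht : 2 ≤ t) {A : Fin n → BTree α} (hA : ∀ i, (A i).IsBTree t) {q : ℕ}
    (hq : ∀ i, BTree.stepBound t (A i).elems.card ≤ q) {l : List (Fin n)} (hl : l.Nodup)
    {o : Timed (List (Item n α))} (ho : o ∈ (initItems A w l).outcomes) :
    o.time ≤ l.length * (w * (q + 1) + 3) + 1 ∧ ∃ S : Fin n → List α,
      o.val = l.map (item A S ∅) ∧
      ∀ i ∈ l, (S i).length ≤ w ∧ ((A i).elems.Nonempty → (S i).length = w) := by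
  classical
  induction l generalizing o with
  | nil =>
    simp only [initItems, mem_outcomes_lift_bind, mem_outcomes_pure] at ho
    obtain ⟨-, rfl, rfl⟩ := ho
    exact ⟨by simp, fun _ => [], rfl, by simp⟩
  | cons i l ih =>
    rw [List.nodup_cons] at hl
    simp only [initItems, mem_outcomes_lift_bind] at ho
    obtain ⟨o1, ⟨o2, ho2, rfl⟩, rfl⟩ := ho
    obtain ⟨R, hR, b, hb, rfl⟩ := mem_outcomes_bind.1 ho2
    obtain ⟨r, hr, c, hc, rfl⟩ := mem_outcomes_bind.1 hb
    rw [mem_outcomes_pure] at hc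
    subst hc
    obtain ⟨h1, S, h2, h3⟩ := ih hl.2 hr
    obtain ⟨k1, R', k2, k3, k4⟩ := randomSamples_outcomes ht (hA i) (hq i) hR
    obtain ⟨s1, s2⟩ := BTree.size_spec (hA i)
    refine ⟨?_, Function.update S i R', ?_, ?_⟩
    · simp only [Timed.tick_time, s2, List.length_cons]
      rw [Nat.succ_mul]
      lia
    · simp only [h2, s1, k2, List.map_cons]
      congr 1
      · simp [item]
      · refine List.map_congr_left fun j hj => ?_
        have : j ≠ i := fun h => hl.1 (h ▸ hj)
        simp [item, this]
    · intro j hj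
      by_cases hji : j = i
      · subst hji
        simpa using ⟨k3, k4⟩
      · rw [Function.update_of_ne hji]
        exact h3 j ((List.mem_cons.1 hj).resolve_left hji)

/-- This is the independence of the draws from one set, in the product form needed for an
exponential moment. -/
theorem expect_randomSamples_prod (ht : 2 ≤ t) {T : BTree α} (hT : T.IsBTree t)
    (hne : T.elems.Nonempty) (g : α → ℝ≥0∞) :
    (randomSamples T w).expect (fun R => (R.map fun a => g a.1).prod) =
      ((∑ x ∈ T.elems, g x) / T.elems.card) ^ w := by
  induction w with
  | zero => simp [randomSamples]
  | succ w ih =>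
    simp only [randomSamples, expect_bind, expect_lift]
    rw [BTree.expect_rand ht hT hne]
    simp only [expect_pure, List.map_cons, List.prod_cons, expect_mul_left, ih]
    rw [← Finset.sum_mul, pow_succ', ENNReal.mul_div_right_comm]

/-- By `exp y ≤ 1 + y + y ^ 2` for `|y| ≤ 1`: the linear term has mean zero, and the quadratic one
is at most `c ^ 2`. -/
theorem expect_exp_le {T : Finset α} (hT : T.Nonempty) (U : Finset α) {c : ℝ} (hc : |c| ≤ 1) :
    (∑ x ∈ T, ENNReal.ofReal (Real.exp
      (c * ((if x ∉ U then 1 else 0) - ((T \ U).card : ℝ) / T.card)))) / (T.card : ℝ≥0∞) ≤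
      ENNReal.ofReal (Real.exp (c ^ 2)) := by
  have hpos : (0 : ℝ) < T.card := by exact_mod_cast hT.card_pos
  set p : ℝ := ((T \ U).card : ℝ) / T.card with hp
  have hp0 : 0 ≤ p := by positivity
  have hp1 : p ≤ 1 := by
    rw [hp, div_le_one hpos]
    exact_mod_cast Finset.card_le_card Finset.sdiff_subset
  have hsum : ∑ x ∈ T, (if x ∉ U then (1 : ℝ) else 0) = p * T.card := by
    rw [hp, div_mul_cancel₀ _ hpos.ne', Finset.sum_boole, Finset.filter_notMem_eq_sdiff]
  rw [← ENNReal.ofReal_sum_of_nonneg (fun _ _ => (Real.exp_pos _).le),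
    ← ENNReal.ofReal_natCast, ← ENNReal.ofReal_div_of_pos hpos]
  refine ENNReal.ofReal_le_ofReal ?_
  rw [div_le_iff₀ hpos]
  calc ∑ x ∈ T, Real.exp (c * ((if x ∉ U then 1 else 0) - p))
      ≤ ∑ x ∈ T, (1 + c * ((if x ∉ U then 1 else 0) - p) + c ^ 2) := by
        refine Finset.sum_le_sum fun x _ => ?_
        have hy : |(if x ∉ U then (1 : ℝ) else 0) - p| ≤ 1 := by
          rw [abs_le]
          split_ifs <;> constructor <;> linarith
        have h1 : |c * ((if x ∉ U then (1 : ℝ) else 0) - p)| ≤ 1 := by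
          rw [abs_mul]
          exact mul_le_one₀ hc (abs_nonneg _) hy
        have h2 := (abs_le.1 (Real.abs_exp_sub_one_sub_id_le h1)).2
        have h3 : (c * ((if x ∉ U then (1 : ℝ) else 0) - p)) ^ 2 ≤ c ^ 2 := by
          rw [mul_pow]
          exact mul_le_of_le_one_right (sq_nonneg c) (by rwa [sq_le_one_iff_abs_le_one])
        linarith
    _ = (c ^ 2 + 1) * T.card := by
        rw [Finset.sum_add_distrib, Finset.sum_add_distrib, ← Finset.mul_sum,
          Finset.sum_sub_distrib, hsum]
        simp
        ring
    _ ≤ Real.exp (c ^ 2) * T.card := by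
        gcongr
        exact Real.add_one_le_exp _

theorem prod_map_exp (R : List α) (U : Finset α) (c p : ℝ) :
    (R.map fun x => ENNReal.ofReal (Real.exp (c * ((if x ∉ U then 1 else 0) - p)))).prod =
      ENNReal.ofReal (Real.exp (c * ((R.countP fun x => decide (x ∉ U) : ℕ) - R.length * p))) := by
  induction R with
  | nil => simp
  | cons x R ih =>
    rw [List.map_cons, List.prod_cons, ih, ← ENNReal.ofReal_mul (Real.exp_pos _).le,
      ← Real.exp_add, List.countP_cons, List.length_cons]
    congr 2
    by_cases hx : x ∈ U <;> simp [hx] <;> ring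

open Classical in
-- Exponential Markov inequality: the threshold contributes `-2 * c ^ 2 * w` and the moment `c ^ 2 *
-- w`. The sign of `c` selects the tail.
theorem expect_tail_le (ht : 2 ≤ t) {T : BTree α} (hT : T.IsBTree t) (hne : T.elems.Nonempty)
    (U : Finset α) {c : ℝ} (hc : |c| ≤ 1) :
    (randomSamples T w).expect (fun R => if 2 * c ^ 2 * w ≤
      c * (((R.map Prod.fst).countP fun x => decide (x ∉ U) : ℕ) -
        w * (((T.elems \ U).card : ℝ) / T.elems.card)) then 1 else 0) ≤
      ENNReal.ofReal (Real.exp (-(c ^ 2 * w))) := by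
  set p : ℝ := ((T.elems \ U).card : ℝ) / T.elems.card with hp
  calc _ ≤ (randomSamples T w).expect (fun R => ENNReal.ofReal (Real.exp (-(2 * c ^ 2 * w))) *
        (R.map fun a => ENNReal.ofReal (Real.exp (c * ((if a.1 ∉ U then 1 else 0) - p)))).prod) := by
        refine expect_mono_of_outcomes fun o ho => ?_
        obtain ⟨-, R, h1, -, h2⟩ := randomSamples_outcomes ht hT le_rfl ho
        split_ifs with h
        · have hm : o.val.map Prod.fst = R := by
            rw [h1, List.map_map]
            exact List.map_id _
          have hcomp : (o.val.map fun a => ENNReal.ofReal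
              (Real.exp (c * ((if a.1 ∉ U then 1 else 0) - p)))) = (o.val.map Prod.fst).map
              fun x => ENNReal.ofReal (Real.exp (c * ((if x ∉ U then 1 else 0) - p))) := by
            rw [List.map_map]
            rfl
          rw [hcomp, prod_map_exp, ← ENNReal.ofReal_mul (Real.exp_pos _).le, ← Real.exp_add,
            ENNReal.one_le_ofReal, Real.one_le_exp_iff, hm, h2 hne]
          rw [hm] at h
          linarith
        · exact zero_le
    _ ≤ ENNReal.ofReal (Real.exp (-(2 * c ^ 2 * w))) * ENNReal.ofReal (Real.exp (c ^ 2)) ^ w := by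
        rw [expect_mul_left, expect_randomSamples_prod ht hT hne
          (fun x => ENNReal.ofReal (Real.exp (c * ((if x ∉ U then 1 else 0) - p))))]
        gcongr
        exact expect_exp_le hne U hc
    _ = ENNReal.ofReal (Real.exp (-(c ^ 2 * w))) := by
        rw [← ENNReal.ofReal_pow (Real.exp_pos _).le, ← ENNReal.ofReal_mul (Real.exp_pos _).le,
          ← Real.exp_nat_mul, ← Real.exp_add]
        ring_nf

/-- The samples `R` give an estimate of the number of elements of `T` outside of `U` whose error is
larger than `d` times the number of elements of `T`. -/
def Deviates (w : ℕ) (d : ℝ) (T U : Finset α) (R : List α) : Prop :=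
  d * T.card < |((R.countP fun x => decide (x ∉ U) : ℕ) : ℝ) / w * T.card - (T \ U).card|

open Classical in
theorem expect_deviates_le (ht : 2 ≤ t) {T : BTree α} (hT : T.IsBTree t) (hw : 0 < w)
    (U : Finset α) {d : ℝ} (hd0 : 0 < d) (hd1 : d ≤ 1) :
    (randomSamples T w).expect (fun R => if Deviates w d T.elems U (R.map Prod.fst) then 1 else 0) ≤
      2 * ENNReal.ofReal (Real.exp (-(d ^ 2 / 4 * w))) := by
  rcases T.elems.eq_empty_or_nonempty with he | hne
  · simp [Deviates, he]
  have hpos : (0 : ℝ) < T.elems.card := by exact_mod_cast hne.card_pos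
  have hw' : (0 : ℝ) < w := by exact_mod_cast hw
  -- With `c = ± d / 2` the threshold `2 * c ^ 2 * w` corresponds to a deviation of `d * w` in the
  -- number of white samples.
  have h1 := expect_tail_le (w := w) ht hT hne U (c := d / 2) (by rw [abs_of_pos] <;> linarith)
  have h2 := expect_tail_le (w := w) ht hT hne U (c := -(d / 2))
    (by rw [abs_neg, abs_of_pos] <;> linarith)
  rw [show (d / 2) ^ 2 = d ^ 2 / 4 by ring] at h1
  rw [show (-(d / 2)) ^ 2 = d ^ 2 / 4 by ring] at h2
  rw [two_mul]
  refine le_trans ?_ (add_le_add h1 h2)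
  rw [← expect_add]
  refine expect_mono _ fun R => ?_
  by_cases hD : Deviates w d T.elems U (R.map Prod.fst)
  · rw [if_pos hD]
    rw [Deviates] at hD
    set r : ℝ := (((R.map Prod.fst).countP fun x => decide (x ∉ U) : ℕ) : ℝ)
    set p : ℝ := ((T.elems \ U).card : ℝ) / T.elems.card with hp
    have hD' : d * w < |r - w * p| := by
      have : r / w * T.elems.card - (T.elems \ U).card = (r - w * p) * (T.elems.card / w) := by
        rw [hp]
        field_simp
      rw [this, abs_mul, abs_of_pos (div_pos hpos hw'), mul_div_assoc', lt_div_iff₀ hw'] at hD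
      nlinarith
    rcases lt_abs.1 hD' with h | h
    · rw [if_pos (by nlinarith)]
      exact le_self_add
    · rw [if_pos (c := 2 * (d ^ 2 / 4) * w ≤ -(d / 2) * (r - w * p)) (by nlinarith)]
      exact le_add_self
  · rw [if_neg hD]
    exact zero_le

open Classical in
-- The union bound runs over all `K` because the set covered in a later round depends on the samples
-- themselves. Fixing `K` beforehand removes this dependence.
theorem expect_exists_deviates_le (ht : 2 ≤ t) {A : Fin n → BTree α} (hA : ∀ i, (A i).IsBTree t)
    (hw : 0 < w) {d : ℝ} (hd0 : 0 < d) (hd1 : d ≤ 1) (k : ℕ) :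
    (initItems A w (List.finRange n)).expect (fun L => (L.map fun a =>
      if ∃ K : Finset (Fin n), K.card ≤ k ∧
        Deviates w d (A a.idx).elems (union A K) (a.samples.map Prod.fst) then 1 else 0).sum) ≤
      n * (∑ i ∈ Finset.range (k + 1), n.choose i : ℕ) *
        (2 * ENNReal.ofReal (Real.exp (-(d ^ 2 / 4 * w)))) := by
  rw [expect_initItems A w _ (fun i R => if ∃ K : Finset (Fin n), K.card ≤ k ∧
    Deviates w d (A i).elems (union A K) (R.map Prod.fst) then 1 else 0)]
  have hcard : ((Finset.univ : Finset (Finset (Fin n))).filter fun K => K.card ≤ k).card =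
      ∑ i ∈ Finset.range (k + 1), n.choose i := by
    rw [Finset.card_eq_sum_card_fiberwise (f := Finset.card) (t := Finset.range (k + 1))]
    · refine Finset.sum_congr rfl fun i hi => ?_
      have hi' : i ≤ k := Nat.lt_succ_iff.1 (Finset.mem_range.1 hi)
      have : (Finset.univ.filter fun K : Finset (Fin n) => K.card ≤ k).filter
          (fun K => K.card = i) = Finset.univ.powersetCard i := by
        ext K
        simp only [Finset.mem_filter, Finset.mem_univ, true_and, Finset.mem_powersetCard,
          Finset.subset_univ]
        exact ⟨fun h => h.2, fun h => ⟨h ▸ hi', h⟩⟩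
      rw [this]
      simp
    · intro K hK
      simpa [Nat.lt_succ_iff] using hK
  refine (List.sum_le_card_nsmul _ ((∑ i ∈ Finset.range (k + 1), n.choose i : ℕ) *
    (2 * ENNReal.ofReal (Real.exp (-(d ^ 2 / 4 * w))))) ?_).trans ?_
  · intro x hx
    obtain ⟨i, -, rfl⟩ := List.mem_map.1 hx
    calc _ ≤ (randomSamples (A i) w).expect (fun R =>
          ∑ K ∈ Finset.univ.filter fun K : Finset (Fin n) => K.card ≤ k,
            if Deviates w d (A i).elems (union A K) (R.map Prod.fst) then 1 else 0) := by
          refine expect_mono _ fun R => ?_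
          split_ifs with h
          · obtain ⟨K, hK, hD⟩ := h
            refine le_trans ?_ (Finset.single_le_sum (fun _ _ => zero_le)
              (Finset.mem_filter.2 ⟨Finset.mem_univ K, hK⟩))
            rw [if_pos hD]
          · exact zero_le
      _ ≤ _ := by
          rw [expect_finset_sum, ← hcard, ← nsmul_eq_mul]
          exact Finset.sum_le_card_nsmul _ _ _ fun K _ =>
            expect_deviates_le ht (hA i) hw (union A K) hd0 hd1
  · simp [mul_assoc]

end MaxCover

namespace MaxCover

/-! ### The number of samples -/

theorem chooseSum_spec (n k : ℕ) :
    (chooseSum n k).val = (n.choose k, ∑ i ∈ Finset.range (k + 1), n.choose i) ∧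
      (chooseSum n k).time = k + 1 := by
  induction k with
  | zero => simp [chooseSum]
  | succ k ih =>
    have h : n.choose k * (n - k) / (k + 1) = n.choose (k + 1) := by
      rw [← Nat.choose_succ_right_eq, Nat.mul_div_cancel _ (Nat.succ_pos k)]
    simp [chooseSum, ih, h, Finset.sum_range_succ _ (k + 1)]

/-- For `x = k / n ≤ 1` one has `x ^ k ≤ x ^ i` when `i ≤ k`, so the sum times `x ^ k` is at most
`(1 + x) ^ n ≤ exp k`. -/
theorem sum_choose_mul_pow_le {n k : ℕ} (hk : 1 ≤ k) (hkn : k ≤ n) :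
    ((∑ i ∈ Finset.range (k + 1), n.choose i : ℕ) : ℝ) ≤ Real.exp (k + k * Real.log (n / k)) := by
  have hk' : (0 : ℝ) < k := by exact_mod_cast hk
  have hn' : (0 : ℝ) < n := by exact_mod_cast hk.trans hkn
  have hx0 : (0 : ℝ) < k / n := by positivity
  have hx1 : (k : ℝ) / n ≤ 1 := (div_le_one hn').2 (by exact_mod_cast hkn)
  have h1 : ((∑ i ∈ Finset.range (k + 1), n.choose i : ℕ) : ℝ) * (k / n : ℝ) ^ k ≤ Real.exp k := by
    calc ((∑ i ∈ Finset.range (k + 1), n.choose i : ℕ) : ℝ) * (k / n : ℝ) ^ k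
        = ∑ i ∈ Finset.range (k + 1), (k / n : ℝ) ^ k * n.choose i := by
          push_cast
          rw [mul_comm, Finset.mul_sum]
      _ ≤ ∑ i ∈ Finset.range (k + 1), (k / n : ℝ) ^ i * n.choose i := by
          refine Finset.sum_le_sum fun i hi => ?_
          gcongr ?_ * _
          exact pow_le_pow_of_le_one hx0.le hx1 (Nat.lt_succ_iff.1 (Finset.mem_range.1 hi))
      _ ≤ ∑ i ∈ Finset.range (n + 1), (k / n : ℝ) ^ i * n.choose i := by
          refine Finset.sum_le_sum_of_subset_of_nonneg ?_ fun _ _ _ => by positivity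
          exact Finset.range_mono (by lia)
      _ = (k / n + 1 : ℝ) ^ n := by
          rw [add_pow]
          simp
      _ ≤ Real.exp (k / n) ^ n := by
          gcongr
          exact Real.add_one_le_exp _
      _ = Real.exp k := by
          rw [← Real.exp_nat_mul]
          congr 1
          field_simp
  rw [Real.exp_add]
  have h2 : Real.exp (k * Real.log (n / k)) * (k / n : ℝ) ^ k = 1 := by
    rw [Real.exp_nat_mul, Real.exp_log (by positivity), ← mul_pow]
    rw [div_mul_div_cancel₀ hk'.ne', div_self hn'.ne', one_pow]
  refine le_of_mul_le_mul_right ?_ (pow_pos hx0 k)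
  rw [mul_assoc, h2, mul_one]
  exact h1

theorem accuracy_eq {ε : ℝ} (h0 : 0 < ε) {k : ℕ} (hk : 1 ≤ k) :
    accuracy ε k = ε * Real.exp (-(1 / 4)) / (4 * Real.exp 1 * k) := by
  have hk' : (1 : ℝ) ≤ k := by exact_mod_cast hk
  refine min_eq_left ?_
  have h1 : Real.exp (-(1 / 4)) ≤ 1 := Real.exp_le_one_iff.2 (by norm_num)
  have h2 : (1 : ℝ) ≤ Real.exp 1 := Real.one_le_exp (by norm_num)
  rw [div_le_iff₀ (by positivity)]
  have : 1 ≤ 4 * Real.exp 1 * k := by nlinarith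
  nlinarith

theorem accuracy_pos {ε : ℝ} (h0 : 0 < ε) {k : ℕ} (hk : 1 ≤ k) : 0 < accuracy ε k := by
  have hk' : (0 : ℝ) < k := by exact_mod_cast hk
  rw [accuracy_eq h0 hk]
  positivity

theorem accuracy_mul_le {ε : ℝ} (h0 : 0 < ε) (h1 : ε < 1) {k : ℕ} (hk : 1 ≤ k) :
    accuracy ε k * (4 * Real.exp 1 * k) ≤ 1 := by
  have hk' : (0 : ℝ) < k := by exact_mod_cast hk
  rw [accuracy_eq h0 hk, div_mul_cancel₀ _ (by positivity)]
  have h1 : Real.exp (-(1 / 4)) ≤ 1 := Real.exp_le_one_iff.2 (by norm_num)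
  nlinarith [Real.exp_pos (-(1 / 4))]

/-- The common factor of the step bounds. -/
noncomputable def logTerm (γ : ℝ) (k n : ℕ) : ℝ := k * Real.log (3 * n / k) + Real.log (1 / γ)

theorem log_three_mul_div {k n : ℕ} (hk : 1 ≤ k) (hkn : k ≤ n) :
    Real.log (3 * n / k) = Real.log 3 + Real.log (n / k) := by
  have hk' : (0 : ℝ) < k := by exact_mod_cast hk
  have hn' : (0 : ℝ) < n := by exact_mod_cast hk.trans hkn
  rw [mul_div_assoc, Real.log_mul (by norm_num) (by positivity)]

theorem one_le_log_three : 1 ≤ Real.log 3 := by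
  rw [Real.le_log_iff_exp_le (by norm_num)]
  linarith [Real.exp_one_lt_d9]

theorem log_div_nonneg {k n : ℕ} (hk : 1 ≤ k) (hkn : k ≤ n) : 0 ≤ Real.log (n / k) := by
  have hk' : (0 : ℝ) < k := by exact_mod_cast hk
  refine Real.log_nonneg ?_
  rw [one_le_div hk']
  exact_mod_cast hkn

theorem one_le_logTerm {γ : ℝ} (h0 : 0 < γ) (h1 : γ < 1) {k n : ℕ} (hk : 1 ≤ k) (hkn : k ≤ n) :
    1 ≤ logTerm γ k n := by
  have hk' : (1 : ℝ) ≤ k := by exact_mod_cast hk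
  have h2 : 0 ≤ Real.log (1 / γ) := Real.log_nonneg (by rw [one_le_div h0]; exact h1.le)
  rw [logTerm, log_three_mul_div hk hkn]
  nlinarith [one_le_log_three, log_div_nonneg hk hkn]

/-- The logarithms of `n` and of the binomial sum are each at most `k + k * log (n / k)`, and `log 4
≤ 2 * log 3`. Since `log 3 ≥ 1`, the factor `4` absorbs everything. -/
theorem log_four_div_le {γ : ℝ} (h0 : 0 < γ) (h1 : γ < 1) {k n : ℕ} (hk : 1 ≤ k) (hkn : k ≤ n) :
    Real.log (4 / (γ / (n * (∑ i ∈ Finset.range (k + 1), n.choose i : ℕ)))) ≤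
      4 * logTerm γ k n := by
  have hk' : (1 : ℝ) ≤ k := by exact_mod_cast hk
  have hn' : (0 : ℝ) < n := by exact_mod_cast hk.trans hkn
  have hN : (0 : ℝ) < (∑ i ∈ Finset.range (k + 1), n.choose i : ℕ) := by
    have : 0 < ∑ i ∈ Finset.range (k + 1), n.choose i :=
      Finset.sum_pos' (fun _ _ => Nat.zero_le _) ⟨0, by simp, by simp⟩
    exact_mod_cast this
  have h2 : 0 ≤ Real.log (1 / γ) := Real.log_nonneg (by rw [one_le_div h0]; exact h1.le)
  have h3 : Real.log ((∑ i ∈ Finset.range (k + 1), n.choose i : ℕ) : ℝ) ≤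
      k + k * Real.log (n / k) := by
    rw [Real.log_le_iff_le_exp hN]
    exact sum_choose_mul_pow_le hk hkn
  have h4 : Real.log n ≤ k + k * Real.log (n / k) := by
    have : (n : ℝ) = k * (n / k) := by field_simp
    rw [this, Real.log_mul (by positivity) (by positivity), ← this]
    have := Real.log_le_sub_one_of_pos (show (0 : ℝ) < k by linarith)
    nlinarith [log_div_nonneg hk hkn]
  have h5 : Real.log 4 ≤ 2 * Real.log 3 := by
    rw [← Real.log_rpow (by norm_num)]
    exact Real.log_le_log (by norm_num) (by norm_num)
  have h6 : (4 : ℝ) / (γ / (n * (∑ i ∈ Finset.range (k + 1), n.choose i : ℕ))) =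
      4 * n * (∑ i ∈ Finset.range (k + 1), n.choose i : ℕ) * (1 / γ) := by
    field_simp
  rw [h6, Real.log_mul (by positivity) (by positivity), Real.log_mul (by positivity) (by positivity),
    Real.log_mul (by positivity) (by positivity), logTerm, log_three_mul_div hk hkn]
  nlinarith [one_le_log_three, log_div_nonneg hk hkn]

theorem sampleCount_time (ε γ : ℝ) (k n : ℕ) : (sampleCount ε γ k n).time = k + 2 := by
  simp [sampleCount, chooseSum_spec]

theorem sampleCount_val (ε γ : ℝ) (k n : ℕ) : (sampleCount ε γ k n).val =
    ⌈18 / (accuracy ε k / (4 * k)) ^ 2 * Real.log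
      (4 / (γ / (n * (∑ i ∈ Finset.range (k + 1), n.choose i : ℕ))))⌉₊ := by
  simp [sampleCount, chooseSum_spec]

theorem sampleCount_le {ε γ : ℝ} (hε : 0 < ε) (hε1 : ε < 1) (h0 : 0 < γ) (h1 : γ < 1) {k n : ℕ}
    (hk : 1 ≤ k) (hkn : k ≤ n) :
    ((sampleCount ε γ k n).val : ℝ) ≤ 2 ^ 20 * (k ^ 4 / ε ^ 2 * logTerm γ k n) := by
  have hk' : (1 : ℝ) ≤ k := by exact_mod_cast hk
  have hΛ := one_le_logTerm h0 h1 hk hkn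
  -- Here `4608 = 18 * 16 ^ 2`, because `ε' = ε * exp (-1/4) / (16 * e * k ^ 2)`.
  have h2 : 18 / (accuracy ε k / (4 * k)) ^ 2 =
      4608 * (Real.exp 1 ^ 2 * Real.exp (1 / 4) ^ 2) * (k ^ 4 / ε ^ 2) := by
    rw [accuracy_eq hε hk, Real.exp_neg]
    have := Real.exp_pos 1
    have := Real.exp_pos (1 / 4)
    field_simp
    norm_num
  have h3 : Real.exp 1 ^ 2 * Real.exp (1 / 4) ^ 2 ≤ 27 := by
    rw [← Real.exp_nat_mul, ← Real.exp_nat_mul, ← Real.exp_add]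
    calc _ ≤ Real.exp (3 * 1) := Real.exp_le_exp.2 (by norm_num)
      _ = Real.exp 1 ^ 3 := by rw [← Real.exp_nat_mul]; norm_num
      _ ≤ (3 : ℝ) ^ 3 := by
        gcongr
        linarith [Real.exp_one_lt_d9]
      _ ≤ 27 := by norm_num
  have h4 : 1 ≤ (k : ℝ) ^ 4 / ε ^ 2 := by
    rw [one_le_div (by positivity)]
    have : ε ^ 2 ≤ 1 := pow_le_one₀ hε.le hε1.le
    have : (1 : ℝ) ≤ (k : ℝ) ^ 4 := one_le_pow₀ hk'
    linarith
  have h5 := log_four_div_le h0 h1 hk hkn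
  -- This absorbs the `+ 1` from rounding up: `4608 * 27 * 4 + 1 ≤ 2 ^ 20`.
  have h6 : 1 ≤ k ^ 4 / ε ^ 2 * logTerm γ k n := by nlinarith
  rw [sampleCount_val, h2]
  set X : ℝ := (k : ℝ) ^ 4 / ε ^ 2
  set Y := Real.log (4 / (γ / (n * (∑ i ∈ Finset.range (k + 1), n.choose i : ℕ))))
  have h7 : 4608 * (Real.exp 1 ^ 2 * Real.exp (1 / 4) ^ 2) * X * Y ≤
      4608 * 27 * X * (4 * logTerm γ k n) := by
    refine (mul_le_mul_of_nonneg_left h5 (by positivity)).trans ?_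
    gcongr
  refine (Nat.cast_le.2 (Nat.ceil_mono h7)).trans ?_
  refine (Nat.ceil_lt_add_one (by positivity)).le.trans ?_
  linarith

/-- For `d = ε' / 2` the exponent `d ^ 2 / 4 = ε' ^ 2 / 16` beats the `ε' ^ 2 / 18` that defines
`w`. Each exponential is thus at most `γ' / 4`, and the total at most `γ / 2`. -/
theorem exp_sampleCount_le {ε γ : ℝ} (hε : 0 < ε) (h0 : 0 < γ) (h1 : γ < 1) {k n : ℕ}
    (hk : 1 ≤ k) (hkn : k ≤ n) :
    0 < (sampleCount ε γ k n).val ∧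
    (n * (∑ i ∈ Finset.range (k + 1), n.choose i : ℕ) : ENNReal) * (2 * ENNReal.ofReal
      (Real.exp (-((accuracy ε k / (8 * k)) ^ 2 / 4 * (sampleCount ε γ k n).val)))) ≤
      ENNReal.ofReal γ := by
  have hk' : (1 : ℝ) ≤ k := by exact_mod_cast hk
  have hn' : (1 : ℝ) ≤ n := by exact_mod_cast hk.trans hkn
  have hN : (1 : ℝ) ≤ (∑ i ∈ Finset.range (k + 1), n.choose i : ℕ) := by
    have : 0 < ∑ i ∈ Finset.range (k + 1), n.choose i :=
      Finset.sum_pos' (fun _ _ => Nat.zero_le _) ⟨0, by simp, by simp⟩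
    exact_mod_cast this
  have hacc := accuracy_pos hε hk
  rw [sampleCount_val]
  set N := ∑ i ∈ Finset.range (k + 1), n.choose i
  set e : ℝ := accuracy ε k / (4 * k) with he
  have he0 : 0 < e := by positivity
  have hpos : (0 : ℝ) < γ / (n * N) := by positivity
  have hle : γ / (n * N) ≤ 1 := by
    rw [div_le_one (by positivity)]
    nlinarith
  have hlog : 0 < Real.log (4 / (γ / (n * N))) := by
    refine Real.log_pos ?_
    rw [one_lt_div hpos]
    linarith
  have hX : 0 < 18 / e ^ 2 * Real.log (4 / (γ / (n * N))) := by positivity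
  refine ⟨Nat.ceil_pos.2 hX, ?_⟩
  have hw := Nat.le_ceil (18 / e ^ 2 * Real.log (4 / (γ / (n * N))))
  set w : ℝ := (⌈18 / e ^ 2 * Real.log (4 / (γ / (n * N)))⌉₊ : ℝ)
  have h2 : accuracy ε k / (8 * k) = e / 2 := by
    rw [he]
    field_simp
    norm_num
  have h3 : Real.log (4 / (γ / (n * N))) ≤ (e / 2) ^ 2 / 4 * w := by
    have : 18 * Real.log (4 / (γ / (n * N))) ≤ e ^ 2 * w := by
      have := mul_le_mul_of_nonneg_left hw (sq_nonneg e)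
      rwa [← mul_assoc, mul_div_cancel₀ _ (by positivity)] at this
    linarith
  have h4 : Real.exp (-((e / 2) ^ 2 / 4 * w)) ≤ γ / (n * N) / 4 := by
    calc Real.exp (-((e / 2) ^ 2 / 4 * w))
        ≤ Real.exp (-Real.log (4 / (γ / (n * N)))) := Real.exp_le_exp.2 (by linarith)
      _ = γ / (n * N) / 4 := by
        rw [Real.exp_neg, Real.exp_log (by positivity), inv_div]
  rw [h2]
  calc _ = ENNReal.ofReal (n * N * (2 * Real.exp (-((e / 2) ^ 2 / 4 * w)))) := by
        rw [ENNReal.ofReal_mul (by positivity), ENNReal.ofReal_mul (by positivity),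
          ENNReal.ofReal_mul (by positivity)]
        simp
    _ ≤ ENNReal.ofReal (n * N * (2 * (γ / (n * N) / 4))) := by
        gcongr
    _ ≤ ENNReal.ofReal γ := by
        refine ENNReal.ofReal_le_ofReal ?_
        have : n * N * (2 * (γ / (n * N) / 4)) = γ / 2 := by
          field_simp
          norm_num
        linarith

/-- With `x = 1 / k`, `log (1 - x) ≤ -x - x ^ 2 / 2` gives `exp (-1) * exp (-x / 2)` for the power,
and `exp (-x / 2) ≤ 1 - x / 4`. The gain over `1 / e` pays for the sampling error. -/
theorem one_sub_inv_pow_le {k : ℕ} (hk : 1 ≤ k) :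
    (1 - 1 / (k : ℝ)) ^ k ≤ 1 / Real.exp 1 * (1 - 1 / (4 * k)) := by
  have hk' : (1 : ℝ) ≤ k := by exact_mod_cast hk
  have hx0 : (0 : ℝ) < 1 / k := by positivity
  have hx1 : 1 / (k : ℝ) ≤ 1 := (div_le_one (by linarith)).2 hk'
  have hx4 : 1 / (4 * k : ℝ) = 1 / k / 4 := by
    field_simp
  rw [hx4]
  set x : ℝ := 1 / k with hx
  have hkx : k * x = 1 := by
    rw [hx]
    field_simp
  have h1 : 1 - x ≤ Real.exp (-(x + x ^ 2 / 2)) := by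
    -- The logarithm series needs `x < 1`; for `k = 1` the left side is zero.
    rcases hx1.lt_or_eq with hlt | heq
    · have h5 := Real.hasSum_pow_div_log_of_abs_lt_one (x := x) (by rwa [abs_of_pos hx0])
      have h6 := sum_le_hasSum (Finset.range 2) (fun i _ => by positivity) h5
      norm_num [Finset.sum_range_succ] at h6
      exact (Real.le_exp_log _).trans (Real.exp_le_exp.2 (by linarith))
    · rw [heq, sub_self]
      exact (Real.exp_pos _).le
  have h2 : Real.exp (-(x / 2)) ≤ 1 - x / 4 := by
    have h3 := (abs_le.1 (Real.abs_exp_sub_one_sub_id_le (x := -(x / 2))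
      (by rw [abs_neg, abs_of_pos] <;> linarith))).2
    nlinarith
  calc (1 - x) ^ k ≤ Real.exp (-(x + x ^ 2 / 2)) ^ k :=
        pow_le_pow_left₀ (by linarith) h1 k
    _ = Real.exp (-1) * Real.exp (-(x / 2)) := by
        rw [← Real.exp_nat_mul, ← Real.exp_add]
        congr 1
        linear_combination (-1 - x / 2) * hkx
    _ ≤ 1 / Real.exp 1 * (1 - x / 4) := by
        rw [Real.exp_neg, ← one_div]
        gcongr

end MaxCover

/-! ### Approximation guarantee of greedy with inexact estimates -/

namespace MaxCover

variable {α : Type} [LinearOrder α] {n k : ℕ}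

theorem card_union_le_optimum (A : Fin n → BTree α) {K : Finset (Fin n)} (hK : K.card = k) :
    (union A K).card ≤ optimum (fun i => (A i).elems) k :=
  Finset.le_sup (f := coverage fun i => (A i).elems)
    (Finset.mem_powersetCard.2 ⟨Finset.subset_univ K, hK⟩)

theorem exists_card_union_eq_optimum (A : Fin n → BTree α) (hk : k ≤ n) :
    ∃ K : Finset (Fin n), K.card = k ∧
      (union A K).card = optimum (fun i => (A i).elems) k := by
  obtain ⟨K, hK, h⟩ := Finset.exists_mem_eq_sup _
    (Finset.powersetCard_nonempty.2 (show k ≤ (Finset.univ : Finset (Fin n)).card by simpa using hk))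
    (coverage fun i => (A i).elems)
  exact ⟨K, (Finset.mem_powersetCard.1 hK).2, h.symm⟩

theorem card_le_maxSize (A : Fin n → BTree α) (i : Fin n) :
    (A i).elems.card ≤ maxSize fun i => (A i).elems :=
  Finset.le_sup (f := fun i => (A i).elems.card) (Finset.mem_univ i)

theorem exists_card_eq_maxSize (A : Fin n → BTree α) (hn : 0 < n) :
    ∃ i, (A i).elems.card = maxSize fun i => (A i).elems := by
  obtain ⟨i, -, h⟩ := Finset.exists_mem_eq_sup (Finset.univ : Finset (Fin n))
    ⟨⟨0, hn⟩, Finset.mem_univ _⟩ (fun i => (A i).elems.card)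
  exact ⟨i, h.symm⟩

theorem maxSize_le_optimum (A : Fin n → BTree α) (hk : 1 ≤ k) (hkn : k ≤ n) :
    maxSize (fun i => (A i).elems) ≤ optimum (fun i => (A i).elems) k := by
  obtain ⟨i, hi⟩ := exists_card_eq_maxSize A (by lia)
  obtain ⟨K, hK, -, hc⟩ := Finset.exists_subsuperset_card_eq (Finset.subset_univ {i})
    (by simpa using hk) (by simpa using hkn)
  rw [← hi]
  refine le_trans (Finset.card_le_card ?_) (card_union_le_optimum A hc)
  exact Finset.subset_biUnion_of_mem (fun i => (A i).elems) (hK (Finset.mem_singleton_self i))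

theorem card_union_insert (A : Fin n → BTree α) (H : Finset (Fin n)) (i : Fin n) :
    (union A (insert i H)).card = (union A H).card + ((A i).elems \ union A H).card := by
  rw [union, Finset.biUnion_insert, Finset.card_union, ← union, Finset.card_sdiff]
  have := Finset.card_le_card (Finset.inter_subset_left (s₁ := (A i).elems) (s₂ := union A H))
  rw [Finset.inter_comm (union A H)]
  lia

/-- An optimal family has `k` members, each adding at most `g` elements to what `H` covers. -/
theorem optimum_le (A : Fin n → BTree α) (hkn : k ≤ n) (H : Finset (Fin n)) {g : ℝ}
    (hg : ∀ i, (((A i).elems \ union A H).card : ℝ) ≤ g) :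
    (optimum (fun i => (A i).elems) k : ℝ) ≤ (union A H).card + k * g := by
  obtain ⟨K, hK, h⟩ := exists_card_union_eq_optimum A hkn
  rw [← h]
  have h1 : union A K ⊆ union A H ∪ K.biUnion fun i => (A i).elems \ union A H := by
    intro x hx
    obtain ⟨i, hi, hx⟩ := Finset.mem_biUnion.1 hx
    by_cases hxH : x ∈ union A H
    · exact Finset.mem_union_left _ hxH
    · exact Finset.mem_union_right _ (Finset.mem_biUnion.2 ⟨i, hi, Finset.mem_sdiff.2 ⟨hx, hxH⟩⟩)
  have h2 : (union A K).card ≤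
      (union A H).card + ∑ i ∈ K, ((A i).elems \ union A H).card :=
    (Finset.card_le_card h1).trans ((Finset.card_union_le _ _).trans
      (Nat.add_le_add_left Finset.card_biUnion_le _))
  have h3 : ∑ i ∈ K, (((A i).elems \ union A H).card : ℝ) ≤ K.card • g :=
    Finset.sum_le_card_nsmul _ _ _ fun i _ => hg i
  rw [nsmul_eq_mul, hK] at h3
  calc ((union A K).card : ℝ)
      ≤ (union A H).card + ∑ i ∈ K, (((A i).elems \ union A H).card : ℝ) := by exact_mod_cast h2
    _ ≤ _ := by linarith

/-- The guarantees on the picked indices `H` and the estimate `z`, when each estimate of a number of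
new elements has an error of at most `D`. -/
structure GreedyInv (A : Fin n → BTree α) (k : ℕ) (D : ℝ) (H : List (Fin n)) (z : ℚ) : Prop where
  opt : (optimum (fun i => (A i).elems) k : ℝ) - (union A H.toFinset).card ≤
    (1 - 1 / (k : ℝ)) ^ H.length * optimum (fun i => (A i).elems) k + H.length * (2 * D)
  est : |(z : ℝ) - (union A H.toFinset).card| ≤ H.length * D
  large : H ≠ [] → (maxSize (fun i => (A i).elems) : ℝ) ≤ (union A H.toFinset).card + 2 * D

theorem greedyInv_nil (A : Fin n → BTree α) (k : ℕ) (D : ℝ) : GreedyInv A k D [] 0 :=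
  ⟨by simp [union], by simp [union], fun h => absurd rfl h⟩

/-- Comparing two estimates costs `D` twice, so every gain is at most `g + 2 * D` and the deficit `O
- c` at most `k * (g + 2 * D)`. Subtracting `g` contracts the deficit by `1 - 1 / k`, up to `2 * D`.
-/
theorem GreedyInv.cons {A : Fin n → BTree α} {D : ℝ} {H : List (Fin n)} {z s : ℚ} {i : Fin n}
    (hk : 1 ≤ k) (hkn : k ≤ n) (hD : 0 ≤ D) (h : GreedyInv A k D H z)
    (hs : |(s : ℝ) - ((A i).elems \ union A H.toFinset).card| ≤ D)
    (hmax : ∀ a, a ∉ H → (((A a).elems \ union A H.toFinset).card : ℝ) ≤ s + D) :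
    GreedyInv A k D (i :: H) (z + s) := by
  have hk' : (1 : ℝ) ≤ k := by exact_mod_cast hk
  obtain ⟨hs1, hs2⟩ := abs_le.1 hs
  set c : ℝ := (((union A H.toFinset).card : ℕ) : ℝ) with hc
  set g : ℝ := ((((A i).elems \ union A H.toFinset).card : ℕ) : ℝ) with hg
  have hg0 : 0 ≤ g := Nat.cast_nonneg _
  have hcov : ((union A (i :: H).toFinset).card : ℝ) = c + g := by
    rw [List.toFinset_cons, card_union_insert]
    push_cast
    rfl
  have hall : ∀ a, (((A a).elems \ union A H.toFinset).card : ℝ) ≤ g + 2 * D := by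
    -- The maximality hypothesis speaks only of remaining sets; those already picked have nothing
    -- new to offer.
    intro a
    by_cases ha : a ∈ H
    · have : (A a).elems \ union A H.toFinset = ∅ := by
        rw [Finset.sdiff_eq_empty_iff_subset]
        exact Finset.subset_biUnion_of_mem (fun i => (A i).elems) (List.mem_toFinset.2 ha)
      rw [this]
      simp
      linarith
    · linarith [hmax a ha]
  have hopt := optimum_le A hkn H.toFinset hall
  rw [← hc] at hopt
  refine ⟨?_, ?_, fun _ => ?_⟩
  · rw [hcov, List.length_cons, pow_succ]
    have h1 := h.opt
    rw [← hc] at h1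
    set O : ℝ := ((optimum (fun i => (A i).elems) k : ℕ) : ℝ)
    have h2 : (1 - 1 / (k : ℝ)) * (O - c) ≤ (1 - 1 / (k : ℝ)) *
        ((1 - 1 / (k : ℝ)) ^ H.length * O + H.length * (2 * D)) := by
      refine mul_le_mul_of_nonneg_left h1 ?_
      have := (div_le_one (show (0 : ℝ) < k by linarith)).2 hk'
      linarith
    have h3 : (O - c) / k ≤ g + 2 * D := by
      rw [div_le_iff₀ (by linarith)]
      linarith
    have h4 : 0 ≤ 1 / (k : ℝ) * (H.length * (2 * D)) := by positivity
    have h5 : (1 - 1 / (k : ℝ)) * (O - c) = O - c - (O - c) / k := by ring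
    push_cast
    linarith
  · rw [hcov, List.length_cons]
    have h1 := h.est
    rw [← hc] at h1
    push_cast
    calc |(z : ℝ) + s - (c + g)| = |(z - c) + (s - g)| := by ring_nf
      _ ≤ |(z : ℝ) - c| + |(s : ℝ) - g| := abs_add_le _ _
      _ ≤ (H.length + 1) * D := by linarith
  -- A largest set is contained in the old union together with its own gain, and that gain is at
  -- most `g + 2 * D`.
  · obtain ⟨a, ha⟩ := exists_card_eq_maxSize A (by lia)
    have h1 : (A a).elems.card ≤ (union A H.toFinset).card +
        ((A a).elems \ union A H.toFinset).card := by
      rw [← card_union_insert]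
      exact Finset.card_le_card (Finset.subset_biUnion_of_mem (fun i => (A i).elems)
        (Finset.mem_insert_self a _))
    rw [ha] at h1
    have h2 : (maxSize (fun i => (A i).elems) : ℝ) ≤
        c + ((A a).elems \ union A H.toFinset).card := by
      rw [hc]
      exact_mod_cast h1
    rw [hcov]
    linarith [hall a]

/-- Here `D = ξ * M / (8 * k)`. The coverage error `2 * k * D = ξ * M / 4` fits into the slack `O /
(4 * e * k)`, and the error `k * D = ξ * M / 8` of `z` is compared with the coverage through
`large`. -/
theorem GreedyInv.guarantee {A : Fin n → BTree α} {ε : ℝ} {H : List (Fin n)} {z : ℚ}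
    (hk : 1 ≤ k) (hkn : k ≤ n) (hε0 : 0 < ε) (hε1 : ε < 1) (hH : H.length = k)
    (h : GreedyInv A k (accuracy ε k / (8 * k) * maxSize fun i => (A i).elems) H z) :
    (1 - 1 / Real.exp 1) * (optimum (fun i => (A i).elems) k : ℝ) ≤
      (union A H.toFinset).card ∧
    (1 - ε) * ((union A H.toFinset).card : ℝ) ≤ z ∧
    (z : ℝ) ≤ (1 + ε) * (union A H.toFinset).card := by
  have hk' : (1 : ℝ) ≤ k := by exact_mod_cast hk
  obtain ⟨h1, h2, h3⟩ := h
  have h4 : (maxSize (fun i => (A i).elems) : ℝ) ≤ optimum (fun i => (A i).elems) k := by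
    exact_mod_cast maxSize_le_optimum A hk hkn
  replace h3 := h3 (by rw [← List.length_pos_iff]; lia)
  rw [hH] at h1 h2
  have hM0 : (0 : ℝ) ≤ maxSize (fun i => (A i).elems) := Nat.cast_nonneg _
  set M : ℝ := ((maxSize (fun i => (A i).elems) : ℕ) : ℝ)
  set O : ℝ := ((optimum (fun i => (A i).elems) k : ℕ) : ℝ)
  set c : ℝ := (((union A H.toFinset).card : ℕ) : ℝ)
  have ha0 := accuracy_pos hε0 hk
  have ha1 := accuracy_mul_le hε0 hε1 hk
  have ha2 : accuracy ε k ≤ ε := min_le_right _ _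
  set a := accuracy ε k
  have he : (2 : ℝ) ≤ Real.exp 1 := by linarith [Real.exp_one_gt_d9]
  have hkD : k * (a / (8 * k) * M) = a / 8 * M := by
    field_simp
  constructor
  · have h5 := mul_le_mul_of_nonneg_right (one_sub_inv_pow_le hk) (hM0.trans h4)
    have h6 : a / 4 ≤ 1 / Real.exp 1 * (1 / (4 * k)) := by
      rw [one_div_mul_one_div, le_div_iff₀ (by positivity)]
      linarith
    have h7 : a / 4 * M ≤ 1 / Real.exp 1 * (1 / (4 * k)) * O :=
      mul_le_mul h6 h4 hM0 (by positivity)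
    linarith
  · have h5 : a / (8 * k) ≤ 1 / 8 := by
      rw [div_le_div_iff₀ (by positivity) (by norm_num)]
      nlinarith
    have h6 : a / (8 * k) * M ≤ 1 / 8 * M := mul_le_mul_of_nonneg_right h5 hM0
    -- By `h6` the term `2 * D` in `h3` is at most `M / 4`, so `M ≤ (4 / 3) * c`.
    have h7 : M ≤ 2 * c := by linarith
    have h8 : a / 8 * M ≤ ε * c := by
      have : a / 8 * M ≤ ε / 8 * (2 * c) := mul_le_mul (by linarith) h7 hM0 (by linarith)
      nlinarith
    rw [hkD] at h2
    obtain ⟨h9, h10⟩ := abs_le.1 h2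
    constructor <;> linarith

theorem abs_estimate_sub_le {A : Fin n → BTree α} {S : Fin n → List α} {w : ℕ} {d : ℝ} (hd : 0 ≤ d)
    {U : Finset α} {i : Fin n} (h : ¬ Deviates w d (A i).elems U (S i)) :
    |(estimate A S w U i : ℝ) - ((A i).elems \ U).card| ≤
      d * maxSize fun i => (A i).elems := by
  rw [Deviates, not_lt] at h
  have h1 : ((A i).elems.card : ℝ) ≤ maxSize fun i => (A i).elems := by
    exact_mod_cast card_le_maxSize A i
  refine le_trans (le_of_eq ?_) (h.trans (mul_le_mul_of_nonneg_left h1 hd))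
  simp [estimate]

theorem map_fst_samples (A : Fin n → BTree α) (S : Fin n → List α) (U : Finset α) (i : Fin n) :
    (item A S U i).samples.map Prod.fst = S i := by
  rw [item, List.map_map]
  exact List.map_id _

/-! ### Success probability and number of steps of the algorithm -/

open scoped ENNReal
open RTimed

variable {t : ℕ} {A : Fin n → BTree α} {ε γ : ℝ}

theorem greedy_guarantee (ht : 2 ≤ t) (hA : ∀ i, (A i).IsBTree t) (hk : 1 ≤ k) (hkn : k ≤ n)
    (hε0 : 0 < ε) (hε1 : ε < 1) {w : ℕ} {S : Fin n → List α} (hS : ∀ i, (S i).length ≤ w)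
    (hdev : ∀ i, ∀ K : Finset (Fin n), K.card ≤ k →
      ¬ Deviates w (accuracy ε k / (8 * k)) (A i).elems (union A K) (S i)) :
    ∀ out, out = (greedy w k ((List.finRange n).map (item A S ∅)) [] 0 []).val →
    out.2.toFinset.card = k ∧
      (1 - 1 / Real.exp 1) * (optimum (fun i => (A i).elems) k : ℝ) ≤
        (coverage (fun i => (A i).elems) out.2.toFinset : ℝ) ∧
      (1 - ε) * (coverage (fun i => (A i).elems) out.2.toFinset : ℝ) ≤ (out.1 : ℝ) ∧
      (out.1 : ℝ) ≤ (1 + ε) * (coverage (fun i => (A i).elems) out.2.toFinset : ℝ) := by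
  rintro out rfl
  have hd : 0 ≤ accuracy ε k / (8 * k) := by
    have := accuracy_pos hε0 hk
    positivity
  have hest : ∀ (H : List (Fin n)) (i : Fin n), H.length < k →
      |(estimate A S w (union A H.toFinset) i : ℝ) - ((A i).elems \ union A H.toFinset).card| ≤
        accuracy ε k / (8 * k) * maxSize fun i => (A i).elems :=
    fun H i hH => abs_estimate_sub_le hd
      (hdev i H.toFinset ((List.toFinset_card_le H).trans hH.le))
  obtain ⟨-, h1, h2, h3⟩ := greedy_spec (S := S) (w := w)
    (fun i x => (BTree.query_spec ht (hA i) x).1)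
    (fun i x => (BTree.query_spec ht (hA i) x).2.trans
      (BTree.stepBound_mono (card_le_maxSize A i))) hS hkn
    (GreedyInv A k (accuracy ε k / (8 * k) * maxSize fun i => (A i).elems))
    (fun H z i hinv _ _ hlen hmax => hinv.cons hk hkn (by positivity) (hest H i hlen)
      fun a ha => by
        have h1 := (abs_le.1 (hest H a hlen)).1
        have h2 : (estimate A S w (union A H.toFinset) a : ℝ) ≤
          estimate A S w (union A H.toFinset) i := by exact_mod_cast hmax a ha
        linarith)
    k (List.finRange n) [] 0 (List.nodup_finRange n) (by simp) List.nodup_nil (by simp)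
    (greedyInv_nil A k _)
  exact ⟨(List.toFinset_card_of_nodup h1).trans h2, h3.guarantee hk hkn hε0 hε1 h2⟩

theorem approximateMaximumCover_prob (ht : 2 ≤ t) (hA : ∀ i, (A i).IsBTree t) (hk : 1 ≤ k)
    (hkn : k ≤ n) (hε0 : 0 < ε) (hε1 : ε < 1) (hγ0 : 0 < γ) (hγ1 : γ < 1) :
    ENNReal.ofReal (1 - γ) ≤ (approximateMaximumCover A k ε γ).prob (fun out =>
      out.2.toFinset.card = k ∧
      (1 - 1 / Real.exp 1) * (optimum (fun i => (A i).elems) k : ℝ) ≤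
        (coverage (fun i => (A i).elems) out.2.toFinset : ℝ) ∧
      (1 - ε) * (coverage (fun i => (A i).elems) out.2.toFinset : ℝ) ≤ (out.1 : ℝ) ∧
      (out.1 : ℝ) ≤ (1 + ε) * (coverage (fun i => (A i).elems) out.2.toFinset : ℝ)) := by
  classical
  have hk' : (1 : ℝ) ≤ k := by exact_mod_cast hk
  have ha0 := accuracy_pos hε0 hk
  have hd0 : 0 < accuracy ε k / (8 * k) := by positivity
  have hd1 : accuracy ε k / (8 * k) ≤ 1 := by
    rw [div_le_one (by positivity)]
    have : accuracy ε k ≤ ε := min_le_right _ _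
    linarith
  obtain ⟨hw, hexp⟩ := exp_sampleCount_le hε0 hγ0 hγ1 hk hkn
  have hbad := (expect_exists_deviates_le ht hA hw hd0 hd1 k).trans hexp
  rw [prob_eq_expect, ENNReal.ofReal_sub _ hγ0.le, ENNReal.ofReal_one, tsub_le_iff_right]
  refine le_trans ?_ (add_le_add_right hbad _)
  rw [approximateMaximumCover, expect_bind, expect_lift, expect_bind, ← expect_add]
  set w := (sampleCount ε γ k n).val
  -- With `1` written as an expectation, it suffices that on every outcome the success indicator
  -- plus the sum of the bad indicators is at least `1`.
  refine (expect_const (initItems A w (List.finRange n)) 1).symm.le.trans ?_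
  refine expect_mono_of_outcomes fun o ho => ?_
  obtain ⟨-, S, hoS, hS⟩ := initItems_outcomes ht hA
    (fun i => BTree.stepBound_mono (card_le_maxSize A i)) (List.nodup_finRange n) ho
  simp only [expect_lift]
  by_cases hdev : ∀ i, ∀ K : Finset (Fin n), K.card ≤ k →
      ¬ Deviates w (accuracy ε k / (8 * k)) (A i).elems (union A K) (S i)
  · refine le_trans ?_ le_self_add
    rw [if_pos]
    exact greedy_guarantee ht hA hk hkn hε0 hε1 (fun i => (hS i (List.mem_finRange i)).1) hdev _
      (by rw [hoS])
  · push Not at hdev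
    obtain ⟨i, K, hK, hD⟩ := hdev
    refine le_trans ?_ le_add_self
    refine le_trans ?_ (List.single_le_sum (fun _ _ => zero_le) _
      (List.mem_map_of_mem (hoS ▸ List.mem_map_of_mem (List.mem_finRange i))))
    rw [if_pos]
    exact ⟨K, hK, by rw [map_fst_samples]; exact hD⟩

theorem approximateMaximumCover_time (ht : 2 ≤ t) (hA : ∀ i, (A i).IsBTree t) (hk : 1 ≤ k)
    (hkn : k ≤ n) (hε0 : 0 < ε) (hγ0 : 0 < γ) (hγ1 : γ < 1) {o : Timed (ℚ × List (Fin n))}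
    (ho : o ∈ (approximateMaximumCover A k ε γ).outcomes) :
    o.time ≤ 21 * (k * n * (sampleCount ε γ k n).val *
      BTree.stepBound t (maxSize fun i => (A i).elems)) := by
  obtain ⟨hw, -⟩ := exp_sampleCount_le hε0 hγ0 hγ1 hk hkn
  rw [approximateMaximumCover, mem_outcomes_lift_bind] at ho
  obtain ⟨o1, ho1, rfl⟩ := ho
  obtain ⟨L, hL, o2, ho2, rfl⟩ := mem_outcomes_bind.1 ho1
  obtain ⟨h1, S, hLS, hS⟩ := initItems_outcomes ht hA
    (fun i => BTree.stepBound_mono (card_le_maxSize A i)) (List.nodup_finRange n) hL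
  rw [mem_outcomes_lift, hLS] at ho2
  obtain ⟨h2, -⟩ := greedy_spec (S := S)
    (fun i x => (BTree.query_spec ht (hA i) x).1)
    (fun i x => (BTree.query_spec ht (hA i) x).2.trans
      (BTree.stepBound_mono (card_le_maxSize A i))) (fun i => (hS i (List.mem_finRange i)).1) hkn
    (fun _ _ => True) (fun _ _ _ _ _ _ _ _ => trivial)
    k (List.finRange n) [] 0 (List.nodup_finRange n) (by simp) List.nodup_nil (by simp) trivial
  subst ho2
  refine (Nat.add_le_add (sampleCount_time ε γ k n).le (Nat.add_le_add h1 h2)).trans ?_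
  rw [List.length_finRange]
  have hq : 1 ≤ BTree.stepBound t (maxSize fun i => (A i).elems) := BTree.one_le_stepBound _
  generalize BTree.stepBound t (maxSize fun i => (A i).elems) = q at *
  generalize (sampleCount ε γ k n).val = w at *
  have hn : 1 ≤ n := hk.trans hkn
  have e1 : w ≤ w * q := Nat.le_mul_of_pos_right w hq
  have e2 : n ≤ n * (w * q) := Nat.le_mul_of_pos_right n (Nat.mul_pos hw hq)
  have e3 : w * (q + 2) + 5 ≤ 8 * (w * q) := by
    have : 1 ≤ w * q := Nat.mul_pos hw hq
    rw [Nat.mul_add]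
    lia
  have e4 : w * (q + 1) + 3 ≤ 5 * (w * q) := by
    have : 1 ≤ w * q := Nat.mul_pos hw hq
    rw [Nat.mul_add]
    lia
  have e5 : n * (w * (q + 2) + 5) + 3 ≤ 11 * (n * (w * q)) := by
    have := Nat.mul_le_mul_left n e3
    rw [Nat.mul_left_comm] at this
    lia
  have e6 : n * (w * (q + 1) + 3) ≤ 5 * (n * (w * q)) := by
    have := Nat.mul_le_mul_left n e4
    rwa [Nat.mul_left_comm] at this
  have e7 : k * (n * (w * (q + 2) + 5) + 3) ≤ 11 * (k * (n * (w * q))) := by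
    have := Nat.mul_le_mul_left k e5
    rwa [Nat.mul_left_comm k] at this
  have e8 : n * (w * q) ≤ k * (n * (w * q)) := Nat.le_mul_of_pos_left _ hk
  have e9 : k * n * w * q = k * (n * (w * q)) := by ring
  -- The rounds account for `11`, the sampling for `5`, and the other `k + 4` steps fit into the
  -- remaining `5`.
  rw [e9]
  lia

theorem boundT_eq (ε γ : ℝ) (k n : ℕ) :
    boundT ε γ k n = k * n * (k ^ 4 / ε ^ 2 * logTerm γ k n) := by
  rw [boundT, logTerm]
  ring

theorem log_add_two_le (m : ℕ) : Real.log (m + 2) ≤ 2 * (1 + Real.log m) := by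
  have h2 : Real.log 3 ≤ 2 := by
    have := Real.log_le_sub_one_of_pos (show (0 : ℝ) < 3 by norm_num)
    linarith
  rcases Nat.lt_or_ge m 2 with hm | hm
  · have h1 : Real.log m = 0 := by
      interval_cases m <;> simp
    rw [h1]
    refine le_trans (Real.log_le_log (by positivity) (y := 3) ?_) (by linarith)
    have : (m : ℝ) ≤ 1 := by exact_mod_cast Nat.le_of_lt_succ hm
    linarith
  · have hm' : (2 : ℝ) ≤ m := by exact_mod_cast hm
    have h3 : Real.log (m + 2) ≤ Real.log ((m : ℝ) ^ 2) :=
      Real.log_le_log (by positivity) (by nlinarith)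
    rw [Real.log_pow] at h3
    push_cast at h3
    linarith

theorem approximateMaximumCover_time_le (ht : 2 ≤ t) (hA : ∀ i, (A i).IsBTree t) (hk : 1 ≤ k)
    (hkn : k ≤ n) (hε0 : 0 < ε) (hε1 : ε < 1) (hγ0 : 0 < γ) (hγ1 : γ < 1)
    {o : Timed (ℚ × List (Fin n))} (ho : o ∈ (approximateMaximumCover A k ε γ).outcomes) :
    (o.time : ℝ) ≤ 21 * 2 ^ 20 * 8 * (32 * t ^ 2 + 24 * t + 20) * (boundT ε γ k n +
      boundR ε γ k n * Real.log (maxSize fun i => (A i).elems) +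
      boundQ ε γ k n * Real.log (maxSize fun i => (A i).elems)) := by
  have h1 := approximateMaximumCover_time ht hA hk hkn hε0 hγ0 hγ1 ho
  have h2 := sampleCount_le hε0 hε1 hγ0 hγ1 hk hkn
  have h3 := BTree.stepBound_le_log (t := t) (maxSize fun i => (A i).elems)
  have h4 := log_add_two_le (maxSize fun i => (A i).elems)
  have hΛ := one_le_logTerm hγ0 hγ1 hk hkn
  have hlog : 0 ≤ Real.log (maxSize fun i => (A i).elems) := Real.log_natCast_nonneg _
  have hR : 0 ≤ boundR ε γ k n := by
    rw [boundR, ← logTerm]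
    positivity
  have hQ : boundQ ε γ k n = boundT ε γ k n := rfl
  rw [hQ]
  have hK : (0 : ℝ) < 32 * t ^ 2 + 24 * t + 20 := by positivity
  calc (o.time : ℝ) ≤ 21 * (k * n * (sampleCount ε γ k n).val *
        BTree.stepBound t (maxSize fun i => (A i).elems)) := by exact_mod_cast h1
    _ ≤ 21 * (k * n * (2 ^ 20 * (k ^ 4 / ε ^ 2 * logTerm γ k n)) *
        (4 * (32 * t ^ 2 + 24 * t + 20) *
          (2 * (1 + Real.log (maxSize fun i => (A i).elems))))) := by
        have h5 := h3.trans (mul_le_mul_of_nonneg_left h4 (by positivity))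
        gcongr
    _ = 21 * 2 ^ 20 * 8 * (32 * t ^ 2 + 24 * t + 20) * (boundT ε γ k n + boundT ε γ k n *
        Real.log (maxSize fun i => (A i).elems)) := by
        rw [boundT_eq]
        ring
    _ ≤ _ := by
        -- Since `boundQ` equals `boundT`, the terms `T` and `Q * log m` already suffice; the `R`
        -- term only has to be nonnegative.
        have := mul_nonneg hR hlog
        gcongr
        linarith

end MaxCover

theorem mainTheorem11 (t : ℕ) (ht : 2 ≤ t) :
    ∃ C : ℝ, 0 < C ∧ ∀ (α : Type) [LinearOrder α],
      -- insertion, deletion, membership query and random sampling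
      (∀ (T : BTree α), T.IsBTree t →
        (∀ x : α,
          ((T.insert t x).val.IsBTree t ∧ (T.insert t x).val.elems = insert x T.elems ∧
            ((T.insert t x).time : ℝ) ≤ C * Real.log (T.elems.card + 2)) ∧
          ((T.delete t x).val.IsBTree t ∧ (T.delete t x).val.elems = T.elems.erase x ∧
            ((T.delete t x).time : ℝ) ≤ C * Real.log (T.elems.card + 2)) ∧
          (((T.query x).val = true ↔ x ∈ T.elems) ∧
            ((T.query x).time : ℝ) ≤ C * Real.log (T.elems.card + 2))) ∧
        (∀ x ∈ T.elems, T.rand.law (some x) = ((T.elems.card : ENNReal))⁻¹) ∧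
        (∀ o ∈ T.rand.outcomes, (o.time : ℝ) ≤ C * Real.log (T.elems.card + 2))) ∧
      -- maximum coverage
      (∀ (n k : ℕ) (A : Fin n → BTree α) (ε γ : ℝ),
        1 ≤ k → k ≤ n → (∀ i, (A i).IsBTree t) → 0 < ε → ε < 1 → 0 < γ → γ < 1 →
        ENNReal.ofReal (1 - γ) ≤
          (MaxCover.approximateMaximumCover A k ε γ).prob (fun out =>
            out.2.toFinset.card = k ∧
            (1 - 1 / Real.exp 1) * (MaxCover.optimum (fun i => (A i).elems) k : ℝ) ≤
              (MaxCover.coverage (fun i => (A i).elems) out.2.toFinset : ℝ) ∧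
            (1 - ε) * (MaxCover.coverage (fun i => (A i).elems) out.2.toFinset : ℝ) ≤ (out.1 : ℝ) ∧
            (out.1 : ℝ) ≤
              (1 + ε) * (MaxCover.coverage (fun i => (A i).elems) out.2.toFinset : ℝ)) ∧
        ∀ o ∈ (MaxCover.approximateMaximumCover A k ε γ).outcomes,
          (o.time : ℝ) ≤ C * (MaxCover.boundT ε γ k n +
            MaxCover.boundR ε γ k n * Real.log (MaxCover.maxSize fun i => (A i).elems) +
            MaxCover.boundQ ε γ k n * Real.log (MaxCover.maxSize fun i => (A i).elems))) := by
  -- The factors come from the step count (`21`), the number of samples (`2 ^ 20`), the passage to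
  -- `1 + log m` (`8 = 4 * 2`) and the cost of one tree level.
  refine ⟨21 * 2 ^ 20 * 8 * (32 * t ^ 2 + 24 * t + 20), by positivity, fun α _ => ⟨?_, ?_⟩⟩
  · intro T hT
    have hC : ∀ c : ℕ, c ≤ BTree.stepBound t T.elems.card →
        (c : ℝ) ≤ 21 * 2 ^ 20 * 8 * (32 * t ^ 2 + 24 * t + 20) *
          Real.log (T.elems.card + 2) := by
      intro c hc
      refine (Nat.cast_le.2 hc).trans ((BTree.stepBound_le_log _).trans ?_)
      have : 0 ≤ Real.log (T.elems.card + 2) := Real.log_nonneg (by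
        have : (0 : ℝ) ≤ T.elems.card := Nat.cast_nonneg _
        linarith)
      gcongr
      norm_num
    refine ⟨fun x => ⟨?_, ?_, ?_⟩, fun x hx => BTree.law_rand ht hT hx,
      fun o ho => hC _ (BTree.rand_outcomes ht hT ho).1⟩
    · obtain ⟨h1, h2, h3⟩ := BTree.insert_spec ht hT x
      exact ⟨h1, h2, hC _ h3⟩
    · obtain ⟨h1, h2, h3⟩ := BTree.delete_spec ht hT x
      exact ⟨h1, h2, hC _ h3⟩
    · obtain ⟨h1, h2⟩ := BTree.query_spec ht hT x
      exact ⟨h1, hC _ h2⟩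
  · intro n k A ε γ hk hkn hA hε0 hε1 hγ0 hγ1
    exact ⟨MaxCover.approximateMaximumCover_prob ht hA hk hkn hε0 hε1 hγ0 hγ1,
      fun o ho => MaxCover.approximateMaximumCover_time_le ht hA hk hkn hε0 hε1 hγ0 hγ1 ho⟩
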